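/- Let $n\ge 1$ and let $[n]^*$ be the free monoid of words over $[n]=\{1<\dots<n\}$. *Quasi-ribbon tableaux.* A quasi-ribbon tableau over $[n]$ is a (possibly empty) finite sequence of nonempty columns $c_1,\dots,c_m$ filled with elements of $[n]$, arranged so that the top box of $c_{k+1}$ stands immediately to the right of the bottom box of $c_k$, with entries strictly increasing down columns and weakly increasing from left to right along rows. Its reading $R(q)\in[n]^*$ lists the entries column by column from left to right, each column from bottom to top. Let $\mathrm{QR}_n$ be the set of these tableaux and $\emptyset$ the empty one. Write $q=[q^1;\dots;q^k]$ for the tableau with rows $q^1,\dots,q^k$ from top to bottom (empty rows being omitted); here the leftmost box of $q^{i+1}$ is below the rightmost box of $q^i$. *Right insertion* of $x\in[n]$ into $q$: if no entry of $q$ is $\le x$, the result is $[(x);q^1;\dots;q^k]$. Otherwise let $q^i$ be the last row having an entry $\le x$, and write $q^i=ab$, where $a$ consists of the entries $\le x$; the result is $[q^1;\dots;q^{i-1};ax;b;q^{i+1};\dots;q^k]$. *Left insertion* of $x$ into $q$: if no entry of $q$ is $\ge x$, the result is $[q^1;\dots;q^k;(x)]$. Otherwise let $q^i$ be the first row having an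 entry $\ge x$, and write $q^i=ab$, where $a$ consists of the entries $<x$; the result is $[q^1;\dots;q^{i-1};a;xb;q^{i+1};\dots;q^k]$. *String data structures.* $\mathrm{QR}_n$ with reading $R$ and right (resp. left) insertion is the right (resp. left) string data structure $\mathbf{QR}^{row}_n$ (resp. $\mathbf{QR}^{left}_n$): $R$ is injective, $R(\emptyset)$ is the empty word, inserting $x$ into $\emptyset$ gives a tableau with reading $x$, and $C(R(q))=q$ for every $q$. Here the constructor $C_{row}(w)$ (resp. $C_{left}(w)$) is the result of inserting successively into $\emptyset$ the letters of $w$ from left to right by right insertion (resp. from right to left by left insertion). For $d,d'\in\mathrm{QR}_n$ let $d\star_{row}d'$ (resp. $d\star_{left}d'$) be the result of inserting in the same way the word $R(d')$ into $d$. *Hypoplactic monoid.* $\mathbf{Hp}_n$ is the monoid generated by $[n]$ subject to the relations $$zxy=xzy\ (x\le y<z),\qquad yzx=yxz\ (x<y\le z),$$ $$zxty=xzyt\ (x\le y<z\le t),\qquad tyzx=ytxz\ (x<y\le z<t),$$ for $x,y,z,t\in[n]$; let $\approx$ be the congruence on $[n]^*$ generated by these relations. **Corollary.** For all $u,v\in[n]^*$,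 $$u\approx v\iff C_{row}(u)=C_{row}(v)\qquad\text{and}\qquad u\approx v\iff C_{left}(u)=C_{left}(v),$$ that is, $\mathbf{QR}^{row}_n$ and $\mathbf{QR}^{left}_n$ satisfy the cross-section property for $\mathbf{Hp}_n$. Moreover the products $\star_{row}$ and $\star_{left}$ on $\mathrm{QR}_n$ are associative, and the structure monoid of $\mathbf{QR}^{row}_n$, that is, $\mathrm{QR}_n$ with the product $\star_{row}$ and the identity $\emptyset$, is isomorphic to $\mathbf{Hp}_n$. -/

import Mathlib

/-! ## String data structures -/

/-- A right string data structure over `[n]` (modelled by `Fin n`); words are lists.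
`insertWord d u` is the insertion of the word `u` into `d`, leftmost letter first. -/
structure RightStringDataStructure (n : ℕ) where
  /-- the underlying set -/
  Data : Type
  /-- the distinguished element -/
  empty : Data
  /-- the insertion of a letter -/
  insert : Data → Fin n → Data
  /-- the reading map -/
  read : Data → List (Fin n)
  read_insert_empty : ∀ x, read (insert empty x) = [x]
  insertWord_read : ∀ d, (read d).foldl insert empty = d
  read_injective : Function.Injective read
  read_empty : read empty = []

namespace RightStringDataStructure

variable {n : ℕ} (S : RightStringDataStructure n)

/-- Insertion of a word, letter by letter, from its leftmost letter to its rightmost letter. -/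
def insertWord (d : S.Data) (u : List (Fin n)) : S.Data := u.foldl S.insert d

/-- The constructor: insertion of a word into the empty data. -/
def constructor (u : List (Fin n)) : S.Data := S.insertWord S.empty u

/-- The product `d ⋆ d'`, insertion of the reading of `d'` into `d`. -/
def star (d d' : S.Data) : S.Data := S.insertWord d (S.read d')

/-- Associativity of the string data structure. -/
def IsAssociative : Prop := ∀ a b c : S.Data, S.star (S.star a b) c = S.star a (S.star b c)

/-- The cross-section property for a congruence on the free monoid. -/
def HasCrossSectionProperty (r : Con (FreeMonoid (Fin n))) : Prop :=
  ∀ u v : List (Fin n),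
    r (FreeMonoid.ofList u) (FreeMonoid.ofList v) ↔ S.constructor u = S.constructor v

/-- The structure monoid of an associative string data structure: its underlying set, with
the product `star` and the identity `empty`. -/
def StructureMonoid (_h : S.IsAssociative) : Type := S.Data

instance (h : S.IsAssociative) : Monoid (S.StructureMonoid h) where
  mul := S.star
  mul_assoc := h
  one := S.empty
  one_mul d := S.insertWord_read d
  mul_one d := by
    change S.insertWord d (S.read S.empty) = d
    rw [S.read_empty]
    rfl

end RightStringDataStructure

/-- A left string data structure over `[n]` (modelled by `Fin n`). The word `u` is inserted into
`d` starting with its rightmost letter. -/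
structure LeftStringDataStructure (n : ℕ) where
  /-- the underlying set -/
  Data : Type
  /-- the distinguished element -/
  empty : Data
  /-- the insertion of a letter -/
  insert : Data → Fin n → Data
  /-- the reading map -/
  read : Data → List (Fin n)
  read_insert_empty : ∀ x, read (insert empty x) = [x]
  insertWord_read : ∀ d, (read d).foldr (fun x e => insert e x) empty = d
  read_injective : Function.Injective read
  read_empty : read empty = []

namespace LeftStringDataStructure

variable {n : ℕ} (S : LeftStringDataStructure n)

/-- Insertion of a word, letter by letter, from its rightmost letter to its leftmost letter. -/
def insertWord (u : List (Fin n)) (d : S.Data) : S.Data := u.foldr (fun x e => S.insert e x) d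

/-- The constructor: insertion of a word into the empty data. -/
def constructor (u : List (Fin n)) : S.Data := S.insertWord u S.empty

/-- The product `d ⋆ d'`, insertion of the reading of `d'` into `d` from the left. -/
def star (d d' : S.Data) : S.Data := S.insertWord (S.read d') d

/-- Associativity of the string data structure. -/
def IsAssociative : Prop := ∀ a b c : S.Data, S.star (S.star a b) c = S.star a (S.star b c)

/-- The cross-section property for a congruence on the free monoid. -/
def HasCrossSectionProperty (r : Con (FreeMonoid (Fin n))) : Prop :=
  ∀ u v : List (Fin n),
    r (FreeMonoid.ofList u) (FreeMonoid.ofList v) ↔ S.constructor u = S.constructor v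

end LeftStringDataStructure

/-! ## Ribbon shapes -/

namespace Ribbon

section

variable {α : Type*}

/-- Glue the boxes of the list `c` before the ribbon `M` whose lines are the lists in `M`,
each box of `c` but the last one being a line on its own, and the last one being put at the
beginning of the first line of `M`. -/
def hook : List α → List (List α) → List (List α)
  | [], M => M
  | [a], [] => [[a]]
  | [a], m :: M => (a :: m) :: M
  | a :: b :: l, M => [a] :: hook (b :: l) M

/-- Given the nonempty columns of a ribbon, from left to right, each of them listed from top to
bottom, where the top box of every column is glued to the right of the bottom box of the
preceding one, this is the list of the rows, from top to bottom, each of them listed from left to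
right. By symmetry the same function computes the columns of a ribbon from its rows. -/
def transpose : List (List α) → List (List α)
  | [] => []
  | c :: L => hook c (transpose L)

/-- Put the row `r` over the rows `M`, unless `r` has no boxes. -/
def consRow : List α → List (List α) → List (List α)
  | [], M => M
  | a :: r, M => (a :: r) :: M

theorem flatten_consRow (r : List α) (M : List (List α)) :
    (consRow r M).flatten = r ++ M.flatten := by
  cases r <;> simp [consRow]

theorem nil_notMem_hook (c : List α) (M : List (List α)) (hM : [] ∉ M) : [] ∉ hook c M := by
  induction c with
  | nil => simpa [hook] using hM
  | cons a l ih =>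
    rcases l with _ | ⟨b, l⟩
    · cases M with
      | nil => simp [hook]
      | cons m M => simp only [List.mem_cons, not_or] at hM; simp [hook, hM.2]
    · simp only [hook, List.mem_cons, not_or]
      exact ⟨by simp, ih⟩

theorem nil_notMem_transpose (L : List (List α)) : [] ∉ transpose L := by
  induction L with
  | nil => simp [transpose]
  | cons c L ih => exact nil_notMem_hook c _ ih

theorem flatten_hook (c : List α) (M : List (List α)) : (hook c M).flatten = c ++ M.flatten := by
  induction c with
  | nil => simp [hook]
  | cons a l ih =>
    rcases l with _ | ⟨b, l⟩
    · cases M <;> simp [hook]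
    · simp [hook, ih]

theorem flatten_transpose (L : List (List α)) : (transpose L).flatten = L.flatten := by
  induction L with
  | nil => rfl
  | cons c L ih => simp [transpose, flatten_hook, ih]

theorem transpose_hook_cons (a : α) (l : List α) (M : List (List α)) :
    transpose (hook (a :: l) M) = (a :: l) :: transpose M ∨ [] ∈ M := by
  induction l generalizing a with
  | nil =>
    rcases M with _ | ⟨_ | ⟨b, m⟩, M⟩ <;> simp [hook, transpose]
  | cons b l ih =>
    refine (ih b).imp_left fun h => ?_
    simp only [hook, transpose, h]

theorem transpose_transpose (L : List (List α)) (hL : [] ∉ L) : transpose (transpose L) = L := by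
  induction L with
  | nil => rfl
  | cons c L ih =>
    simp only [List.mem_cons, not_or] at hL
    rcases c with _ | ⟨a, l⟩
    · exact absurd rfl hL.1
    · have h := (transpose_hook_cons a l (transpose L)).resolve_right (nil_notMem_transpose L)
      change transpose (hook (a :: l) (transpose L)) = _
      rw [h, ih hL.2]

end

/-! ## The insertion algorithms on the list of rows of a quasi-ribbon tableau -/

section

variable {α : Type*} [LinearOrder α]

/-- Right insertion of `x`. If no entry is `≤ x`, a row consisting of `x` is put over all rows.
Otherwise, in the last row having an entry `≤ x`, the boxes whose entries are `≤ x` (an initial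
segment, the row being weakly increasing), followed by `x`, form a row, and the remaining boxes
(if any) form a new row, put below. -/
def rightInsertRows (x : α) : List (List α) → List (List α)
  | [] => [[x]]
  | r :: rs =>
    if ∃ s ∈ rs, ∃ y ∈ s, y ≤ x then r :: rightInsertRows x rs
    else (r.takeWhile (fun y => decide (y ≤ x)) ++ [x]) ::
      consRow (r.dropWhile (fun y => decide (y ≤ x))) rs

/-- Left insertion of `x`. If no entry is `≥ x`, a row consisting of `x` is put below all rows.
Otherwise, in the first row having an entry `≥ x`, the boxes whose entries are `< x` (an initial
segment, the row being weakly increasing) form a row (if there are any), and `x` followed by the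
remaining boxes forms a new row, put below. -/
def leftInsertRows (x : α) : List (List α) → List (List α)
  | [] => [[x]]
  | r :: rs =>
    if ∃ y ∈ r, x ≤ y then
      consRow (r.takeWhile (fun y => decide (y < x)))
        ((x :: r.dropWhile (fun y => decide (y < x))) :: rs)
    else r :: leftInsertRows x rs

/-- Rows of a quasi-ribbon tableau: nonempty, weakly increasing, and every entry is strictly
smaller than all entries of lower rows. -/
def IsRows (M : List (List α)) : Prop :=
  [] ∉ M ∧ (∀ r ∈ M, r.Pairwise (· ≤ ·)) ∧ M.Pairwise (fun r s => ∀ a ∈ r, ∀ b ∈ s, a < b)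

/-- Columns of a quasi-ribbon tableau: nonempty, strictly increasing from top to bottom, and such
that the rows of the ribbon formed by these columns are weakly increasing. -/
def IsCols (L : List (List α)) : Prop :=
  [] ∉ L ∧ (∀ c ∈ L, c.Pairwise (· < ·)) ∧ ∀ r ∈ transpose L, r.Pairwise (· ≤ ·)

theorem isRows_cons {r : List α} {M : List (List α)} : IsRows (r :: M) ↔
    r ≠ [] ∧ r.Pairwise (· ≤ ·) ∧ (∀ a ∈ r, ∀ b ∈ M.flatten, a < b) ∧ IsRows M := by
  simp only [IsRows, List.forall_mem_cons, List.mem_cons (a := ([] : List α)), not_or,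
    List.pairwise_cons, List.mem_flatten]
  constructor
  · rintro ⟨⟨h1, h2⟩, ⟨h3, h4⟩, h5, h6⟩
    exact ⟨fun h => h1 h.symm, h3, fun a ha b ⟨s, hs, hb⟩ => h5 s hs a ha b hb, h2, h4, h6⟩
  · rintro ⟨h1, h3, h5, h2, h4, h6⟩
    exact ⟨⟨fun h => h1 h.symm, h2⟩, ⟨h3, h4⟩, fun s hs a ha b hb => h5 a ha b ⟨s, hs, hb⟩, h6⟩

theorem isRows_hook (a : α) (l : List α) (M : List (List α)) (hM : IsRows M)
    (hl : (a :: l).Pairwise (· < ·)) (hr : ∀ r ∈ hook (a :: l) M, r.Pairwise (· ≤ ·)) :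
    IsRows (hook (a :: l) M) ∧ ∀ y ∈ (hook (a :: l) M).flatten, a ≤ y := by
  induction l generalizing a with
  | nil =>
    rcases M with _ | ⟨m, M⟩
    · simp [hook, IsRows]
    · rw [isRows_cons] at hM
      obtain ⟨h1, h2, h3, h4⟩ := hM
      obtain ⟨b, m, rfl⟩ := List.exists_cons_of_ne_nil h1
      have hp := hr (a :: b :: m) (by simp [hook])
      have ha := (List.pairwise_cons.1 hp).1
      have hM' : ∀ y ∈ M.flatten, a < y := fun y hy =>
        lt_of_le_of_lt (ha b (by simp)) (h3 b (by simp) y hy)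
      refine ⟨isRows_cons.2 ⟨by simp, hp, ?_, h4⟩, ?_⟩
      · intro c hc y hy
        rcases List.mem_cons.1 hc with rfl | hc
        · exact hM' y hy
        · exact h3 c hc y hy
      · intro y hy
        simp only [hook, List.flatten_cons, List.cons_append, List.mem_cons, List.mem_append] at hy
        rcases hy with rfl | rfl | hy | hy
        · exact le_rfl
        · exact ha _ (by simp)
        · exact ha y (by simp [hy])
        · exact (hM' y hy).le
  | cons b l ih =>
    rw [List.pairwise_cons] at hl
    obtain ⟨h1, h2⟩ := ih b hl.2 (fun r h => hr r (by simp [hook, h]))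
    have hab : a < b := hl.1 b (by simp)
    have h3 : ∀ y ∈ (hook (b :: l) M).flatten, a < y := fun y hy => lt_of_lt_of_le hab (h2 y hy)
    refine ⟨isRows_cons.2 ⟨by simp, by simp, by simpa using h3, h1⟩, ?_⟩
    intro y hy
    simp only [hook, List.flatten_cons, List.cons_append, List.nil_append, List.mem_cons] at hy
    rcases hy with rfl | hy
    · exact le_rfl
    · exact (h3 y hy).le

theorem hook_rows_tail (a : α) (l : List α) (M : List (List α))
    (hr : ∀ r ∈ hook (a :: l) M, r.Pairwise (· ≤ ·)) : ∀ r ∈ M, r.Pairwise (· ≤ ·) := by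
  induction l generalizing a with
  | nil =>
    rcases M with _ | ⟨m, M⟩
    · simp
    · simp only [hook, List.forall_mem_cons, List.pairwise_cons] at hr ⊢
      exact ⟨hr.1.2, hr.2⟩
  | cons b l ih => exact ih b (fun r h => hr r (by simp [hook, h]))

theorem IsCols.isRows_transpose {L : List (List α)} (h : IsCols L) : IsRows (transpose L) := by
  induction L with
  | nil => simp [transpose, IsRows]
  | cons c L ih =>
    obtain ⟨h1, h2, h3⟩ := h
    simp only [List.mem_cons, not_or] at h1
    obtain ⟨a, l, rfl⟩ := List.exists_cons_of_ne_nil (fun h => h1.1 h.symm)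
    have := ih ⟨h1.2, fun c hc => h2 c (by simp [hc]), hook_rows_tail a l _ h3⟩
    exact (isRows_hook a l _ this (h2 _ (by simp)) h3).1

theorem cols_hook (a : α) (l : List α) (M : List (List α)) (hM : ∀ c ∈ M, c.Pairwise (· < ·))
    (h : ∀ b ∈ a :: l, ∀ y ∈ M.flatten, b < y) :
    ∀ c ∈ hook (a :: l) M, c.Pairwise (· < ·) := by
  induction l generalizing a with
  | nil =>
    rcases M with _ | ⟨m, M⟩
    · simp [hook]
    · simp only [hook, List.forall_mem_cons, List.pairwise_cons] at hM ⊢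
      exact ⟨⟨fun y hy => h a (by simp) y (by simp [hy]), hM.1⟩, hM.2⟩
  | cons b l ih =>
    simp only [hook, List.forall_mem_cons]
    exact ⟨by simp, ih b (fun x hx => h x (by simp [List.mem_cons.1 hx]))⟩

theorem IsRows.isCols_transpose {M : List (List α)} (h : IsRows M) : IsCols (transpose M) := by
  refine ⟨nil_notMem_transpose M, ?_, by rw [transpose_transpose M h.1]; exact h.2.1⟩
  induction M with
  | nil => simp [transpose]
  | cons r M ih =>
    rw [isRows_cons] at h
    obtain ⟨h1, -, h3, h4⟩ := h
    obtain ⟨a, l, rfl⟩ := List.exists_cons_of_ne_nil h1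
    exact cols_hook a l _ (ih h4) (by rw [flatten_transpose]; exact h3)

theorem isRows_consRow {r : List α} {M : List (List α)} (h1 : r.Pairwise (· ≤ ·))
    (h2 : ∀ a ∈ r, ∀ b ∈ M.flatten, a < b) (h3 : IsRows M) : IsRows (consRow r M) := by
  cases r with
  | nil => exact h3
  | cons a r => exact isRows_cons.2 ⟨by simp, h1, h2, h3⟩

theorem takeWhile_le (x : α) (r : List α) : ∀ y ∈ r.takeWhile (fun y => decide (y ≤ x)), y ≤ x :=
  fun y hy => by simpa using List.mem_takeWhile_imp hy

theorem takeWhile_lt (x : α) (r : List α) : ∀ y ∈ r.takeWhile (fun y => decide (y < x)), y < x :=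
  fun y hy => by simpa using List.mem_takeWhile_imp hy

theorem lt_dropWhile (x : α) (r : List α) (hr : r.Pairwise (· ≤ ·)) :
    ∀ y ∈ r.dropWhile (fun y => decide (y ≤ x)), x < y := by
  induction r with
  | nil => simp
  | cons a r ih =>
    rw [List.pairwise_cons] at hr
    by_cases h : a ≤ x
    · simpa [List.dropWhile_cons, h] using ih hr.2
    · intro y hy
      simp only [List.dropWhile_cons, h, decide_false, Bool.false_eq_true, if_false,
        List.mem_cons] at hy
      rcases hy with rfl | hy
      · exact not_le.1 h
      · exact lt_of_lt_of_le (not_le.1 h) (hr.1 y hy)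

theorem le_dropWhile (x : α) (r : List α) (hr : r.Pairwise (· ≤ ·)) :
    ∀ y ∈ r.dropWhile (fun y => decide (y < x)), x ≤ y := by
  induction r with
  | nil => simp
  | cons a r ih =>
    rw [List.pairwise_cons] at hr
    by_cases h : a < x
    · simpa [List.dropWhile_cons, h] using ih hr.2
    · intro y hy
      simp only [List.dropWhile_cons, h, decide_false, Bool.false_eq_true, if_false,
        List.mem_cons] at hy
      rcases hy with rfl | hy
      · exact not_lt.1 h
      · exact (not_lt.1 h).trans (hr.1 y hy)

theorem mem_flatten_rightInsertRows (x : α) (M : List (List α)) :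
    ∀ y ∈ (rightInsertRows x M).flatten, y = x ∨ y ∈ M.flatten := by
  induction M with
  | nil => simp [rightInsertRows]
  | cons r M ih =>
    intro y hy
    rw [rightInsertRows] at hy
    split_ifs at hy
    · rw [List.flatten_cons, List.mem_append] at hy
      rcases hy with hy | hy
      · simp [hy]
      · rcases ih y hy with h | h
        · exact Or.inl h
        · simp only [List.flatten_cons, List.mem_append]; exact Or.inr (Or.inr h)
    · simp only [List.flatten_cons, flatten_consRow, List.mem_append, List.mem_singleton] at hy ⊢
      rcases hy with (hy | hy) | hy | hy
      · exact Or.inr (Or.inl ((List.takeWhile_sublist _).subset hy))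
      · exact Or.inl hy
      · exact Or.inr (Or.inl ((List.dropWhile_sublist _).subset hy))
      · exact Or.inr (Or.inr hy)

theorem mem_flatten_leftInsertRows (x : α) (M : List (List α)) :
    ∀ y ∈ (leftInsertRows x M).flatten, y = x ∨ y ∈ M.flatten := by
  induction M with
  | nil => simp [leftInsertRows]
  | cons r M ih =>
    intro y hy
    rw [leftInsertRows] at hy
    split_ifs at hy
    · simp only [List.flatten_cons, flatten_consRow, List.mem_append, List.mem_cons] at hy ⊢
      rcases hy with hy | (hy | hy) | hy
      · exact Or.inr (Or.inl ((List.takeWhile_sublist _).subset hy))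
      · exact Or.inl hy
      · exact Or.inr (Or.inl ((List.dropWhile_sublist _).subset hy))
      · exact Or.inr (Or.inr hy)
    · rw [List.flatten_cons, List.mem_append] at hy
      rcases hy with hy | hy
      · simp [hy]
      · rcases ih y hy with h | h
        · exact Or.inl h
        · simp only [List.flatten_cons, List.mem_append]; exact Or.inr (Or.inr h)

theorem IsRows.rightInsertRows (x : α) {M : List (List α)} (h : IsRows M) :
    IsRows (rightInsertRows x M) := by
  induction M with
  | nil => simp [Ribbon.rightInsertRows, IsRows]
  | cons r M ih =>
    rw [isRows_cons] at h
    obtain ⟨h1, h2, h3, h4⟩ := h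
    rw [Ribbon.rightInsertRows]
    split_ifs with hc
    · refine isRows_cons.2 ⟨h1, h2, fun a ha y hy => ?_, ih h4⟩
      rcases mem_flatten_rightInsertRows x M y hy with rfl | hy
      · obtain ⟨s, hs, b, hb, hbx⟩ := hc
        exact lt_of_lt_of_le (h3 a ha b (List.mem_flatten.2 ⟨s, hs, hb⟩)) hbx
      · exact h3 a ha y hy
    · push Not at hc
      have hx : ∀ y ∈ M.flatten, x < y := fun y hy => by
        obtain ⟨s, hs, hy⟩ := List.mem_flatten.1 hy
        exact hc s hs y hy
      have ht := takeWhile_le x r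
      have hd := lt_dropWhile x r h2
      have hlt : ∀ a ∈ r.takeWhile (fun y => decide (y ≤ x)) ++ [x], a ≤ x := by
        intro a ha
        rcases List.mem_append.1 ha with ha | ha
        · exact ht a ha
        · exact (List.mem_singleton.1 ha).le
      refine isRows_cons.2 ⟨by simp, ?_, ?_, isRows_consRow ?_ ?_ h4⟩
      · rw [List.pairwise_append]
        exact ⟨h2.sublist (List.takeWhile_sublist _), by simp, by simpa using ht⟩
      · intro a ha y hy
        rw [flatten_consRow, List.mem_append] at hy
        rcases hy with hy | hy
        · exact lt_of_le_of_lt (hlt a ha) (hd y hy)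
        · exact lt_of_le_of_lt (hlt a ha) (hx y hy)
      · exact h2.sublist (List.dropWhile_sublist _)
      · exact fun a ha => h3 a ((List.dropWhile_sublist _).subset ha)

theorem IsRows.leftInsertRows (x : α) {M : List (List α)} (h : IsRows M) :
    IsRows (leftInsertRows x M) := by
  induction M with
  | nil => simp [Ribbon.leftInsertRows, IsRows]
  | cons r M ih =>
    rw [isRows_cons] at h
    obtain ⟨h1, h2, h3, h4⟩ := h
    rw [Ribbon.leftInsertRows]
    split_ifs with hc
    · obtain ⟨b, hb, hxb⟩ := hc
      have hx : ∀ y ∈ M.flatten, x < y := fun y hy => lt_of_le_of_lt hxb (h3 b hb y hy)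
      have ht := takeWhile_lt x r
      have hd := le_dropWhile x r h2
      refine isRows_consRow (h2.sublist (List.takeWhile_sublist _)) ?_
        (isRows_cons.2 ⟨by simp, ?_, ?_, h4⟩)
      · intro a ha y hy
        simp only [List.flatten_cons, List.cons_append, List.mem_cons, List.mem_append] at hy
        rcases hy with rfl | hy | hy
        · exact ht a ha
        · exact lt_of_lt_of_le (ht a ha) (hd y hy)
        · exact (ht a ha).trans (hx y hy)
      · exact List.pairwise_cons.2 ⟨hd, h2.sublist (List.dropWhile_sublist _)⟩
      · intro a ha y hy
        rcases List.mem_cons.1 ha with rfl | ha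
        · exact hx y hy
        · exact h3 a ((List.dropWhile_sublist _).subset ha) y hy
    · push Not at hc
      refine isRows_cons.2 ⟨h1, h2, fun a ha y hy => ?_, ih h4⟩
      rcases mem_flatten_leftInsertRows x M y hy with rfl | hy
      · exact hc a ha
      · exact h3 a ha y hy

/-! ### Insertion of the reading of a column -/

theorem rightInsertRows_hook (x a : α) (l : List α) (M : List (List α))
    (h : ∀ b ∈ a :: l, b ≤ x) :
    rightInsertRows x (hook (a :: l) M) = hook (a :: l) (rightInsertRows x M) := by
  induction l generalizing a with
  | nil =>
    have ha : a ≤ x := h a (by simp)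
    rcases M with _ | ⟨m, M⟩
    · simp [hook, rightInsertRows, consRow, ha]
    · simp only [hook, rightInsertRows]
      split_ifs with hc
      · rfl
      · simp [hook, ha]
  | cons b l ih =>
    have hb : ∃ s ∈ hook (b :: l) M, ∃ y ∈ s, y ≤ x := by
      have : b ∈ (hook (b :: l) M).flatten := by simp [flatten_hook]
      obtain ⟨s, hs, hbs⟩ := List.mem_flatten.1 this
      exact ⟨s, hs, b, hbs, h b (by simp)⟩
    simp only [hook]
    rw [rightInsertRows, if_pos hb, ih b (fun c hc => h c (by simp [List.mem_cons.1 hc]))]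

theorem rightInsertRows_append (x : α) (A B : List (List α)) (hA : [] ∉ A)
    (h : ∀ y ∈ A.flatten, y ≤ x) :
    transpose (rightInsertRows x (transpose (A ++ B))) =
      A ++ transpose (rightInsertRows x (transpose B)) := by
  have key : rightInsertRows x (transpose (A ++ B)) =
      transpose (A ++ transpose (rightInsertRows x (transpose B))) ∧
      [] ∉ A ++ transpose (rightInsertRows x (transpose B)) ∨
      [] ∈ rightInsertRows x (transpose B) := by
    induction A with
    | nil =>
      by_cases h0 : [] ∈ rightInsertRows x (transpose B)
      · exact Or.inr h0
      · exact Or.inl ⟨(transpose_transpose _ h0).symm, nil_notMem_transpose _⟩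
    | cons c A ih =>
      simp only [List.mem_cons, not_or] at hA
      obtain ⟨a, l, rfl⟩ := List.exists_cons_of_ne_nil (fun h => hA.1 h.symm)
      refine (ih hA.2 (fun y hy => h y (List.mem_append_right _ hy))).imp_left fun hh => ?_
      constructor
      · simp only [List.cons_append, transpose]
        rw [rightInsertRows_hook x a l _ (fun b hb => h b (List.mem_append_left _ hb)), hh.1]
      · simpa using hh.2
  have hne : [] ∉ rightInsertRows x (transpose B) := by
    have hB := nil_notMem_transpose B
    generalize transpose B = M at hB
    induction M with
    | nil => simp [rightInsertRows]
    | cons r M ih =>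
      simp only [List.mem_cons, not_or] at hB
      rw [rightInsertRows]
      split_ifs
      · simp only [List.mem_cons, not_or]; exact ⟨hB.1, ih hB.2⟩
      · simp only [List.mem_cons, not_or]
        refine ⟨by simp, ?_⟩
        cases List.dropWhile (fun y => decide (y ≤ x)) r <;> simp [consRow, hB.2]
  obtain ⟨h1, h2⟩ := key.resolve_right hne
  rw [h1, transpose_transpose _ h2]

theorem rightInsertRows_column (x : α) (c : List α) (h : ∀ y ∈ c, x < y) :
    rightInsertRows x (hook c []) = hook (x :: c) [] := by
  rcases c with _ | ⟨a, l⟩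
  · rfl
  · have hmem : ∀ y ∈ (hook (a :: l) []).flatten, x < y := by simpa [flatten_hook] using h
    generalize hM : hook (a :: l) [] = M at hmem
    simp only [hook, hM]
    have hne : [] ∉ M := hM ▸ nil_notMem_hook _ _ (by simp)
    rcases M with _ | ⟨r, M⟩
    · rfl
    · simp only [List.mem_cons, not_or] at hne
      obtain ⟨b, m, rfl⟩ := List.exists_cons_of_ne_nil (fun h => hne.1 h.symm)
      rw [rightInsertRows, if_neg]
      · have hb : ¬ b ≤ x := not_le.2 (hmem b (by simp))
        simp [hb, consRow]
      · rintro ⟨s, hs, y, hy, hyx⟩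
        refine absurd hyx (not_le.2 (hmem y ?_))
        rw [List.flatten_cons, List.mem_append]
        exact Or.inr (List.mem_flatten.2 ⟨s, hs, hy⟩)

theorem leftInsertRows_hook (x a : α) (l : List α) (M : List (List α)) (hM : [] ∉ M)
    (h : ∀ b ∈ a :: l, b < x) (h' : ∀ b ∈ M.flatten, x ≤ b) :
    leftInsertRows x (hook (a :: l) M) = hook (a :: l ++ [x]) M := by
  induction l generalizing a with
  | nil =>
    have ha : a < x := h a (by simp)
    rcases M with _ | ⟨_ | ⟨b, m⟩, M⟩
    · simp [hook, leftInsertRows, ha]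
    · simp at hM
    · have hb : x ≤ b := h' b (by simp)
      simp [hook, leftInsertRows, ha, hb, consRow, hb.not_gt]
  | cons b l ih =>
    have hb : ¬ ∃ y ∈ [a], x ≤ y := by simpa using h a (by simp)
    simp only [hook, List.cons_append]
    rw [leftInsertRows, if_neg hb, ih b (fun c hc => h c (by simp [List.mem_cons.1 hc]))]
    rfl

theorem leftInsertRows_all (x : α) (M : List (List α)) (hM : [] ∉ M)
    (h : ∀ b ∈ M.flatten, x ≤ b) : leftInsertRows x M = hook [x] M := by
  rcases M with _ | ⟨_ | ⟨b, m⟩, M⟩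
  · rfl
  · simp at hM
  · have hb : x ≤ b := h b (by simp)
    simp [hook, leftInsertRows, hb, consRow, hb.not_gt]

end

end Ribbon

/-! ## Quasi-ribbon tableaux -/

/-- A quasi-ribbon tableau over `[n]`, given by its nonempty columns, from left to right, each
listed from top to bottom. The top box of a column stands to the right of the bottom box of
the preceding column; so the columns determine the tableau. Columns strictly increase from top
to bottom and rows weakly increase from left to right. -/
@[ext]
structure QuasiRibbon (n : ℕ) where
  /-- the columns -/
  cols : List (List (Fin n))
  cols_ne_nil : [] ∉ cols
  cols_strict : ∀ c ∈ cols, c.Pairwise (· < ·)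
  rows_weak : ∀ r ∈ Ribbon.transpose cols, r.Pairwise (· ≤ ·)

namespace QuasiRibbon

open Ribbon

variable {n : ℕ}

theorem isCols (q : QuasiRibbon n) : IsCols q.cols := ⟨q.cols_ne_nil, q.cols_strict, q.rows_weak⟩

/-- The rows of a quasi-ribbon tableau, from top to bottom, each listed from left to right. -/
def rows (q : QuasiRibbon n) : List (List (Fin n)) := transpose q.cols

/-- The quasi-ribbon tableau with given rows. -/
def ofRows (M : List (List (Fin n))) (h : IsRows M) : QuasiRibbon n :=
  ⟨transpose M, h.isCols_transpose.1, h.isCols_transpose.2.1, h.isCols_transpose.2.2⟩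

/-- The empty tableau. -/
def empty : QuasiRibbon n := ⟨[], by simp, by simp, by simp [transpose]⟩

/-- The right insertion algorithm. -/
def rightInsert (q : QuasiRibbon n) (x : Fin n) : QuasiRibbon n :=
  ofRows (rightInsertRows x q.rows) (q.isCols.isRows_transpose.rightInsertRows x)

/-- The left insertion algorithm. -/
def leftInsert (q : QuasiRibbon n) (x : Fin n) : QuasiRibbon n :=
  ofRows (leftInsertRows x q.rows) (q.isCols.isRows_transpose.leftInsertRows x)

/-- The south-west reading: column-wise from left to right, from bottom to top. -/
def read (q : QuasiRibbon n) : List (Fin n) := (q.cols.map List.reverse).flatten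

theorem cols_rightInsert (q : QuasiRibbon n) (x : Fin n) :
    (q.rightInsert x).cols = transpose (rightInsertRows x (transpose q.cols)) := rfl

theorem cols_leftInsert (q : QuasiRibbon n) (x : Fin n) :
    (q.leftInsert x).cols = transpose (leftInsertRows x (transpose q.cols)) := rfl

theorem IsCols_le {c : List (Fin n)} {L : List (List (Fin n))} (h : IsCols (c :: L)) :
    IsCols L ∧ ∀ a ∈ c, ∀ y ∈ L.flatten, a ≤ y := by
  obtain ⟨h1, h2, h3⟩ := h
  simp only [List.mem_cons, not_or] at h1
  obtain ⟨a, l, rfl⟩ := List.exists_cons_of_ne_nil (fun h => h1.1 h.symm)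
  have hL : IsCols L := ⟨h1.2, fun c hc => h2 c (by simp [hc]), hook_rows_tail a l _ h3⟩
  refine ⟨hL, ?_⟩
  have hl := h2 (a :: l) (by simp)
  have h3 : ∀ r ∈ hook (a :: l) (transpose L), r.Pairwise (· ≤ ·) := h3
  have hM := hL.isRows_transpose
  rw [← flatten_transpose L]
  generalize transpose L = M at h3 hM
  rename ∀ r ∈ transpose ((a :: l) :: L), r.Pairwise (· ≤ ·) => h0
  clear h0 h1 h2
  induction l generalizing a with
  | nil =>
    intro b hb y hy
    obtain rfl := List.mem_singleton.1 hb
    exact (isRows_hook b [] M hM hl h3).2 y (by rw [flatten_hook]; simp [hy])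
  | cons b l ih =>
    rw [List.pairwise_cons] at hl
    have := ih b hl.2 (fun r h => h3 r (by simp [hook, h]))
    intro c hc y hy
    rcases List.mem_cons.1 hc with rfl | hc
    · exact (hl.1 b (by simp)).le.trans (this b (by simp) y hy)
    · exact this c hc y hy

theorem foldl_column (q : QuasiRibbon n) (c : List (Fin n)) (hc : c ≠ [])
    (hs : c.Pairwise (· < ·)) (h : ∀ a ∈ q.cols.flatten, ∀ y ∈ c, a ≤ y) :
    (c.reverse.foldl rightInsert q).cols = q.cols ++ [c] := by
  have key : ∀ c : List (Fin n), c.Pairwise (· < ·) → (∀ a ∈ q.cols.flatten, ∀ y ∈ c, a ≤ y) →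
      (c.reverse.foldl rightInsert q).cols = q.cols ++ transpose (hook c []) := by
    intro c hs h
    induction c with
    | nil => simp [hook, transpose]
    | cons x c ih =>
      rw [List.pairwise_cons] at hs
      have ih := ih hs.2 (fun a ha y hy => h a ha y (by simp [hy]))
      rw [List.reverse_cons, List.foldl_append]
      change (rightInsert _ x).cols = _
      rw [cols_rightInsert, ih,
        rightInsertRows_append x _ _ q.cols_ne_nil (fun a ha => h a ha x (by simp)),
        transpose_transpose _ (nil_notMem_hook c [] (by simp)), rightInsertRows_column x c hs.1]
  rw [key c hs h]
  obtain ⟨a, l, rfl⟩ := List.exists_cons_of_ne_nil hc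
  rw [(transpose_hook_cons a l []).resolve_right (by simp)]
  rfl

theorem foldl_read (q : QuasiRibbon n) : q.read.foldl rightInsert empty = q := by
  have key : ∀ (L : List (List (Fin n))) (p : QuasiRibbon n), IsCols L →
      (∀ a ∈ p.cols.flatten, ∀ y ∈ L.flatten, a ≤ y) →
      ((L.map List.reverse).flatten.foldl rightInsert p).cols = p.cols ++ L := by
    intro L
    induction L with
    | nil => intro p _ _; simp
    | cons c L ih =>
      intro p hL h
      obtain ⟨hL', hc⟩ := IsCols_le hL
      have h1 : c ≠ [] := fun h => hL.1 (by simp [h])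
      have h2 := foldl_column p c h1 (hL.2.1 c (by simp))
        (fun a ha y hy => h a ha y (by simp [hy]))
      rw [List.map_cons, List.flatten_cons, List.foldl_append, ih _ hL', h2]
      · simp
      · rw [h2]
        intro a ha y hy
        rw [List.flatten_append, List.mem_append] at ha
        rcases ha with ha | ha
        · exact h a ha y (by rw [List.flatten_cons]; exact List.mem_append_right _ hy)
        · exact hc a (by simpa using ha) y hy
  ext1
  exact (key q.cols empty q.isCols (by simp [empty])).trans rfl

theorem foldr_read (q : QuasiRibbon n) :
    q.read.foldr (fun x e => leftInsert e x) empty = q := by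
  have hcol : ∀ (c : List (Fin n)) (p : QuasiRibbon n), c ≠ [] → c.Pairwise (· < ·) →
      (∀ a ∈ c, ∀ y ∈ p.cols.flatten, a ≤ y) →
      (c.reverse.foldr (fun x e => leftInsert e x) p).cols = c :: p.cols := by
    intro c p
    induction c using List.reverseRecOn with
    | nil => intro h; exact absurd rfl h
    | append_singleton c x ih =>
      intro _ hs h
      rw [List.reverse_append]
      change (leftInsert (c.reverse.foldr (fun x e => leftInsert e x) p) x).cols = _
      rw [cols_leftInsert]
      have hx : ∀ y ∈ (transpose p.cols).flatten, x ≤ y := by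
        rw [flatten_transpose]; exact h x (by simp)
      rcases c with _ | ⟨a, l⟩
      · have : ([] : List (Fin n)).reverse.foldr (fun x e => leftInsert e x) p = p := rfl
        rw [this, leftInsertRows_all x _ (nil_notMem_transpose _) hx,
          (transpose_hook_cons x [] _).resolve_right (nil_notMem_transpose _),
          transpose_transpose _ p.cols_ne_nil]
        rfl
      · rw [List.pairwise_append] at hs
        rw [ih (by simp) hs.1 (fun b hb => h b (List.mem_append_left _ hb))]
        change transpose (leftInsertRows x (hook (a :: l) (transpose p.cols))) = _
        rw [leftInsertRows_hook x a l _ (nil_notMem_transpose _)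
          (fun b hb => hs.2.2 b hb x (by simp)) hx, List.cons_append,
          (transpose_hook_cons a (l ++ [x]) _).resolve_right (nil_notMem_transpose _),
          transpose_transpose _ p.cols_ne_nil]
  have key : ∀ L : List (List (Fin n)), IsCols L →
      ((L.map List.reverse).flatten.foldr (fun x e => leftInsert e x) empty).cols = L := by
    intro L
    induction L with
    | nil => intro _; rfl
    | cons c L ih =>
      intro hL
      obtain ⟨hL', hc⟩ := IsCols_le hL
      have h1 : c ≠ [] := fun h => hL.1 (by simp [h])
      rw [List.map_cons, List.flatten_cons, List.foldr_append,
        hcol c _ h1 (hL.2.1 c (by simp)) (by rw [ih hL']; exact hc), ih hL']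
  ext1
  exact key q.cols q.isCols

theorem read_injective : Function.Injective (read : QuasiRibbon n → List (Fin n)) :=
  Function.LeftInverse.injective (g := fun u => u.foldl rightInsert empty)
    (fun q => foldl_read q)

end QuasiRibbon

/-- The right string data structure of quasi-ribbon tableaux. -/
def Qrow (n : ℕ) : RightStringDataStructure n where
  Data := QuasiRibbon n
  empty := QuasiRibbon.empty
  insert := QuasiRibbon.rightInsert
  read := QuasiRibbon.read
  read_insert_empty _ := rfl
  insertWord_read := QuasiRibbon.foldl_read
  read_injective := QuasiRibbon.read_injective
  read_empty := rfl

/-- The left string data structure of quasi-ribbon tableaux. -/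
def Qleft (n : ℕ) : LeftStringDataStructure n where
  Data := QuasiRibbon n
  empty := QuasiRibbon.empty
  insert := QuasiRibbon.leftInsert
  read := QuasiRibbon.read
  read_insert_empty _ := rfl
  insertWord_read := QuasiRibbon.foldr_read
  read_injective := QuasiRibbon.read_injective
  read_empty := rfl

/-! ## The hypoplactic monoid -/

/-- The defining relations of the hypoplactic monoid: the two families of Knuth relations, and the
two families of quartic relations. -/
inductive HypoplacticRel (n : ℕ) : FreeMonoid (Fin n) → FreeMonoid (Fin n) → Prop
  | knuth_left (x y z : Fin n) : x ≤ y → y < z →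
      HypoplacticRel n (.ofList [z, x, y]) (.ofList [x, z, y])
  | knuth_right (x y z : Fin n) : x < y → y ≤ z →
      HypoplacticRel n (.ofList [y, z, x]) (.ofList [y, x, z])
  | quartic_left (x y z t : Fin n) : x ≤ y → y < z → z ≤ t →
      HypoplacticRel n (.ofList [z, x, t, y]) (.ofList [x, z, y, t])
  | quartic_right (x y z t : Fin n) : x < y → y ≤ z → z < t →
      HypoplacticRel n (.ofList [t, y, z, x]) (.ofList [y, t, x, z])

/-- The hypoplactic congruence on the free monoid over `[n]`. -/
def hypoplacticCon (n : ℕ) : Con (FreeMonoid (Fin n)) := conGen (HypoplacticRel n)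

/-- The hypoplactic monoid of rank `n`, as a presented monoid. -/
abbrev HypoplacticMonoid (n : ℕ) : Type := PresentedMonoid (HypoplacticRel n)

/-! ### Adding a row that may be empty. -/

namespace Ribbon

section

variable {α : Type*}

/-! Everything goes through one invariant of a word: its multiset of letters together with the set
of intervals [a, b] on which its letters form a weakly increasing subword (`IntervalEquiv`). Both
the tableaux and the hypoplactic classes turn out to be classified by it.

Tableaux: sort the letters of u and cut between consecutive values a < b whenever u is not
increasing on [a, b]. The pieces are the rows of exactly one tableau (`IsRowsOf`,
`IsRowsOf.unique`). Right insertion updates these rows as a letter is appended to u, left insertion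
as a letter is prepended. So the two constructors agree, and they identify two words exactly when
the invariants agree (`foldl_eq_foldl_iff`).

Congruence: the defining relations preserve the invariant. For the converse, the key fact is that
adjacent letters y < z commute as soon as some w with y < w ≤ z stands anywhere on their left, or
some w with y ≤ w < z anywhere on their right (`HypoEquiv.swap`). The defining relations only use
nearby witnesses; `swapLeft` reaches arbitrary distance by induction. Given equivalent words, the
next letter of the first is then carried to the front of the second by adjacent swaps: a missing
witness would make one word increasing, and the other not, on the interval between the two letters.

Associativity and the isomorphism follow formally from the cross-section property. -/

theorem mem_consRow {r s : List α} {M : List (List α)} (h : s ∈ consRow r M) : s = r ∨ s ∈ M := by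
  cases r with
  | nil => exact Or.inr h
  | cons a r => exact List.mem_cons.1 h

theorem pairwise_consRow {R : List α → List α → Prop} {r : List α} {M : List (List α)}
    (h : ∀ s ∈ M, R r s) (hM : M.Pairwise R) : (consRow r M).Pairwise R := by
  cases r with
  | nil => exact hM
  | cons a r => exact List.pairwise_cons.2 ⟨h, hM⟩

end

/-! ## Words that are weakly increasing on an interval -/

section

variable {α : Type*} [LinearOrder α]

/-- The letters of the word `u` that lie between `a` and `b` form a weakly increasing word. -/
def SortedOn (u : List α) (a b : α) : Prop := u.Pairwise fun c d => a ≤ d → c ≤ b → c ≤ d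

theorem SortedOn.mono {u : List α} {a b a' b' : α} (h : SortedOn u a b) (ha : a ≤ a')
    (hb : b' ≤ b) : SortedOn u a' b' :=
  List.Pairwise.imp (fun h h1 h2 => h (ha.trans h1) (h2.trans hb)) h

theorem SortedOn.sublist {u v : List α} {a b : α} (h : SortedOn v a b) (huv : u.Sublist v) :
    SortedOn u a b :=
  List.Pairwise.sublist huv h

theorem sortedOn_append {u v : List α} {a b : α} : SortedOn (u ++ v) a b ↔
    SortedOn u a b ∧ SortedOn v a b ∧ ∀ c ∈ u, ∀ d ∈ v, a ≤ d → c ≤ b → c ≤ d :=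
  List.pairwise_append

theorem sortedOn_cons {x : α} {u : List α} {a b : α} : SortedOn (x :: u) a b ↔
    (∀ d ∈ u, a ≤ d → x ≤ b → x ≤ d) ∧ SortedOn u a b :=
  List.pairwise_cons

theorem sortedOn_nil {a b : α} : SortedOn [] a b := List.Pairwise.nil

theorem sortedOn_self (u : List α) (a : α) : SortedOn u a a :=
  List.pairwise_of_forall fun _ _ h1 h2 => h2.trans h1

theorem sortedOn_of_lt (u : List α) {a b : α} (h : b ≤ a) : SortedOn u a b :=
  List.pairwise_of_forall fun _ _ h1 h2 => (h2.trans h).trans h1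

/-- It suffices to look at intervals whose end points are letters of the word. -/
theorem sortedOn_iff_mem {u : List α} {a b : α} : SortedOn u a b ↔
    ∀ c ∈ u, ∀ d ∈ u, a ≤ c → d ≤ b → SortedOn u c d := by
  refine ⟨fun h c _ d _ hc hd => h.mono hc hd, fun h => ?_⟩
  refine List.pairwise_iff_forall_sublist.2 fun {c d} hs hd hc => ?_
  -- For c before d, the interval to test is [d, c]: sortedness there says precisely that c ≤ d.
  have hcd := (h d (hs.subset (by simp)) c (hs.subset (by simp)) hd hc).sublist hs
  simpa [sortedOn_cons, sortedOn_nil] using hcd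

/-- Two words are interval equivalent if they have the same letters and are weakly increasing on
the same intervals. -/
def IntervalEquiv (u v : List α) : Prop := u.Perm v ∧ ∀ a b, SortedOn u a b ↔ SortedOn v a b

theorem IntervalEquiv.symm {u v : List α} (h : IntervalEquiv u v) : IntervalEquiv v u :=
  ⟨h.1.symm, fun a b => (h.2 a b).symm⟩

theorem IntervalEquiv.trans {u v w : List α} (h : IntervalEquiv u v) (h' : IntervalEquiv v w) :
    IntervalEquiv u w :=
  ⟨h.1.trans h'.1, fun a b => (h.2 a b).trans (h'.2 a b)⟩

/-- Comparing letters across the two factors depends only on which letters occur in each, and a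
permutation keeps these. -/
theorem IntervalEquiv.append {u u' v v' : List α} (h : IntervalEquiv u u')
    (h' : IntervalEquiv v v') : IntervalEquiv (u ++ v) (u' ++ v') := by
  refine ⟨h.1.append h'.1, fun a b => ?_⟩
  simp only [sortedOn_append, h.2, h'.2, h.1.mem_iff, h'.1.mem_iff]

/-! ## The rows associated with a word -/

/-- The rows `M` of a quasi-ribbon tableau have the letters of `u`, and two letters are in the same
row exactly when `u` is weakly increasing on the interval between them. -/
structure IsRowsOf (u : List α) (M : List (List α)) : Prop where
  isRows : IsRows M
  perm : M.flatten.Perm u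
  sortedOn : ∀ r ∈ M, ∀ a ∈ r, ∀ b ∈ r, SortedOn u a b
  not_sortedOn : M.Pairwise fun r s => ∀ a ∈ r, ∀ b ∈ s, ¬ SortedOn u a b

theorem IsRowsOf.congr {u v : List α} {M : List (List α)} (h : IsRowsOf u M)
    (huv : IntervalEquiv u v) : IsRowsOf v M :=
  ⟨h.isRows, h.perm.trans huv.1, fun r hr a ha b hb => (huv.2 a b).1 (h.sortedOn r hr a ha b hb),
    h.not_sortedOn.imp fun h a ha b hb hs => h a ha b hb ((huv.2 a b).2 hs)⟩

theorem IsRows.flatten_pairwise {M : List (List α)} (h : IsRows M) :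
    M.flatten.Pairwise (· ≤ ·) :=
  List.pairwise_flatten.2 ⟨h.2.1, h.2.2.imp fun h a ha b hb => (h a ha b hb).le⟩

-- The word recovers the cuts: any two entries of a row pass the test, while the last entry of a row
-- and the first entry of the next one fail it.
open Classical in
theorem IsRowsOf.splitBy {u : List α} {M : List (List α)} (h : IsRowsOf u M) :
    M.flatten.splitBy (fun a b => decide (SortedOn u a b)) = M := by
  refine List.splitBy_eq_iff.2 ⟨rfl, h.isRows.1, fun r hr => ?_, ?_⟩
  · refine List.Pairwise.isChain (List.Pairwise.imp_of_mem (R := fun _ _ => True) ?_ ?_)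
    · exact fun ha hb _ => decide_eq_true (h.sortedOn r hr _ ha _ hb)
    · exact List.pairwise_of_forall fun _ _ => trivial
  · refine List.Pairwise.isChain (List.Pairwise.imp_of_mem ?_ h.not_sortedOn)
    intro r s hr hs hrs
    have hr' : r ≠ [] := fun e => h.isRows.1 (e ▸ hr)
    have hs' : s ≠ [] := fun e => h.isRows.1 (e ▸ hs)
    exact ⟨hr', hs', decide_eq_false (hrs _ (List.getLast_mem hr') _ (List.head_mem hs'))⟩

/-- The concatenated rows are the sorted rearrangement of u, and u determines where to cut it. -/
theorem IsRowsOf.unique {u : List α} {M N : List (List α)} (hM : IsRowsOf u M)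
    (hN : IsRowsOf u N) : M = N := by
  have h : M.flatten = N.flatten :=
    (hM.perm.trans hN.perm.symm).eq_of_pairwise' hM.isRows.flatten_pairwise
      hN.isRows.flatten_pairwise
  rw [← hM.splitBy, h, hN.splitBy]

/-- For entries in different rows, either a is in the higher row and sortedness fails, or b is and
then b < a, so the condition is void. -/
theorem IsRowsOf.sortedOn_iff {u : List α} {M : List (List α)} (hM : IsRowsOf u M) {a b : α}
    (ha : a ∈ u) (hb : b ∈ u) :
    SortedOn u a b ↔ b ≤ a ∨ ∃ r ∈ M, a ∈ r ∧ b ∈ r := by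
  refine ⟨fun h => ?_, ?_⟩
  · obtain ⟨r, hr, har⟩ := List.mem_flatten.1 (hM.perm.mem_iff.2 ha)
    obtain ⟨s, hs, hbs⟩ := List.mem_flatten.1 (hM.perm.mem_iff.2 hb)
    by_cases hrs : r = s
    · exact Or.inr ⟨r, hr, har, hrs ▸ hbs⟩
    · have key := (hM.isRows.2.2.and hM.not_sortedOn).imp (S := fun r s => (a ∈ r → b ∈ s → False) ∧
        (b ∈ r → a ∈ s → b < a)) fun h' => ⟨fun ha hb => h'.2 a ha b hb h, fun hb ha =>
          h'.1 b hb a ha⟩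
      rw [List.pairwise_iff_getElem] at key
      obtain ⟨i, hi, rfl⟩ := List.getElem_of_mem hr
      obtain ⟨j, hj, rfl⟩ := List.getElem_of_mem hs
      rcases lt_trichotomy i j with hij | rfl | hij
      · exact ((key i j hi hj hij).1 har hbs).elim
      · exact absurd rfl hrs
      · exact Or.inl ((key j i hj hi hij).2 hbs har).le
  · rintro (h | ⟨r, hr, har, hbr⟩)
    · exact sortedOn_of_lt u h
    · exact hM.sortedOn r hr a har b hbr

theorem IsRowsOf.intervalEquiv {u v : List α} {M : List (List α)} (hu : IsRowsOf u M)
    (hv : IsRowsOf v M) : IntervalEquiv u v := by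
  have huv := hu.perm.symm.trans hv.perm
  refine ⟨huv, fun a b => ?_⟩
  rw [sortedOn_iff_mem, sortedOn_iff_mem (u := v)]
  simp only [← huv.mem_iff]
  refine forall₄_congr fun c hc d hd => ?_
  rw [hu.sortedOn_iff hc hd, hv.sortedOn_iff (huv.mem_iff.1 hc) (huv.mem_iff.1 hd)]

/-! ### Insertion updates the rows associated with a word. -/

theorem perm_rightInsertRows (x : α) (M : List (List α)) :
    (rightInsertRows x M).flatten.Perm (M.flatten ++ [x]) := by
  induction M with
  | nil => simp [rightInsertRows]
  | cons r M ih =>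
    rw [rightInsertRows]
    split_ifs
    · simpa using ih.append_left r
    · rw [List.flatten_cons, flatten_consRow, List.flatten_cons]
      conv_rhs => rw [← List.takeWhile_append_dropWhile (p := fun y => decide (y ≤ x)) (l := r)]
      simp only [List.append_assoc]
      refine List.Perm.append_left _ ?_
      rw [← List.append_assoc _ _ [x]]
      exact List.perm_append_comm

theorem perm_leftInsertRows (x : α) (M : List (List α)) :
    (leftInsertRows x M).flatten.Perm (x :: M.flatten) := by
  induction M with
  | nil => simp [leftInsertRows]
  | cons r M ih =>
    rw [leftInsertRows]
    split_ifs
    · rw [flatten_consRow, List.flatten_cons, List.flatten_cons]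
      conv_rhs => rw [← List.takeWhile_append_dropWhile (p := fun y => decide (y < x)) (l := r)]
      rw [List.append_assoc, List.cons_append]
      exact List.perm_middle
    · exact (ih.append_left r).trans List.perm_middle

/-- Appending x only creates descents ending at x, so it spoils exactly the intervals [a, b] with a
≤ x that contain a letter of u in (x, b]. The induction removes upper rows while u stays fixed;
`hlow` records that the letters of u outside M are smaller than all of M. -/
theorem sortedOn_rightInsertRows (x : α) (u : List α) (M : List (List α)) (hM : IsRows M)
    (hsub : ∀ y ∈ M.flatten, y ∈ u) (hlow : ∀ c ∈ u, c ∈ M.flatten ∨ ∀ m ∈ M.flatten, c < m)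
    (hs : ∀ r ∈ M, ∀ a ∈ r, ∀ b ∈ r, SortedOn u a b)
    (hn : M.Pairwise fun r s => ∀ a ∈ r, ∀ b ∈ s, ¬ SortedOn u a b) :
    (∀ r ∈ rightInsertRows x M, ∀ a ∈ r, ∀ b ∈ r, SortedOn (u ++ [x]) a b) ∧
    (rightInsertRows x M).Pairwise fun r s => ∀ a ∈ r, ∀ b ∈ s, ¬ SortedOn (u ++ [x]) a b := by
  induction M with
  | nil => simp [rightInsertRows, sortedOn_self]
  | cons r M ih =>
    rw [isRows_cons] at hM
    obtain ⟨hne, hr, hlt, hM⟩ := hM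
    rw [List.pairwise_cons] at hn
    obtain ⟨hn1, hn⟩ := hn
    have hur : ∀ y ∈ r, y ∈ u := fun y hy => hsub y (by simp [hy])
    have hsub' : ∀ y ∈ M.flatten, y ∈ u := fun y hy =>
      hsub y (by rw [List.flatten_cons]; exact List.mem_append_right _ hy)
    have hold : ∀ {a b}, SortedOn (u ++ [x]) a b → SortedOn u a b :=
      fun h => (sortedOn_append.1 h).1
    have hnew : ∀ {a b}, SortedOn u a b → (a ≤ x → b ≤ x) → SortedOn (u ++ [x]) a b := by
      intro a b h hb
      refine sortedOn_append.2 ⟨h, by simp [sortedOn_cons, sortedOn_nil], ?_⟩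
      intro c _ d hd had hcb
      rw [List.mem_singleton.1 hd] at had ⊢
      exact hcb.trans (hb had)
    have hdesc : ∀ {a b}, b ∈ u → a ≤ x → x < b → ¬ SortedOn (u ++ [x]) a b := by
      intro a b hb hax hxb h
      exact absurd ((sortedOn_append.1 h).2.2 b hb x (by simp) hax le_rfl) hxb.not_ge
    rw [rightInsertRows]
    split_ifs with hc
    · obtain ⟨ih1, ih2⟩ := ih hM hsub' (fun c hcu => by
          rcases hlow c hcu with h | h
          · rw [List.flatten_cons, List.mem_append] at h
            exact h.symm.imp_right fun h m hm => hlt c h m hm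
          · exact Or.inr fun m hm => h m (by
              rw [List.flatten_cons]; exact List.mem_append_right _ hm))
        (fun s h => hs s (List.mem_cons_of_mem _ h)) hn
      obtain ⟨s, hsM, y, hy, hyx⟩ := hc
      have hyM : y ∈ M.flatten := List.mem_flatten.2 ⟨s, hsM, hy⟩
      refine ⟨List.forall_mem_cons.2 ⟨fun a ha b hb => hnew (hs r (by simp) a ha b hb) fun _ =>
        (hlt b hb y hyM).le.trans hyx, ih1⟩, List.pairwise_cons.2 ⟨fun s' hs' a ha b hb h => ?_, ih2⟩⟩
      rcases mem_flatten_rightInsertRows x M b (List.mem_flatten.2 ⟨s', hs', hb⟩) with rfl | hbM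
      · exact hn1 s hsM a ha y hy ((hold h).mono le_rfl hyx)
      · obtain ⟨t, ht, hbt⟩ := List.mem_flatten.1 hbM
        exact hn1 t ht a ha b hbt (hold h)
    · push Not at hc
      have hx : ∀ y ∈ M.flatten, x < y := fun y hy => by
        obtain ⟨s, hs, hy⟩ := List.mem_flatten.1 hy
        exact hc s hs y hy
      have ht := takeWhile_le x r
      have htr := (List.takeWhile_sublist (fun y => decide (y ≤ x)) (l := r)).subset
      have hd := lt_dropWhile x r hr
      have hdr := (List.dropWhile_sublist (fun y => decide (y ≤ x)) (l := r)).subset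
      -- A letter c ≤ x cannot come from the lower rows. It is in r, where sortedness is known, or
      -- it is smaller than a, hence no obstruction.
      have hax : ∀ a ∈ r, SortedOn u a x := by
        intro a ha
        refine List.Pairwise.imp_of_mem (R := fun c d => c ∈ r → a ≤ d → c ≤ d) ?_ ?_
        · intro c d hcu hdu h had hcx
          rcases hlow c hcu with hcM | hcM
          · rw [List.flatten_cons, List.mem_append] at hcM
            rcases hcM with hcr | hcM
            · exact h hcr had
            · exact absurd (hx c hcM) hcx.not_gt
          · exact (hcM a (by simp [ha])).le.trans had
        · refine List.pairwise_iff_forall_sublist.2 fun {c d} hcd hcr had => ?_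
          have := (hs r (by simp) a ha c hcr).sublist hcd
          exact (sortedOn_cons.1 this).1 d (by simp) had le_rfl
      generalize r.takeWhile (fun y => decide (y ≤ x)) = A at ht htr
      generalize r.dropWhile (fun y => decide (y ≤ x)) = B at hd hdr
      refine ⟨?_, List.pairwise_cons.2 ⟨?_, pairwise_consRow ?_ ?_⟩⟩
      · intro s hs' a ha b hb
        rcases List.mem_cons.1 hs' with rfl | hs'
        · have hbx : b ≤ x := by
            rcases List.mem_append.1 hb with hb | hb
            · exact ht b hb
            · exact (List.mem_singleton.1 hb).le
          rcases List.mem_append.1 ha with ha | ha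
          · exact hnew ((hax a (htr ha)).mono le_rfl hbx) fun _ => hbx
          · rw [List.mem_singleton.1 ha]
            exact sortedOn_of_lt _ hbx
        · rcases mem_consRow hs' with rfl | hs'
          · exact hnew (hs r (by simp) a (hdr ha) b (hdr hb)) fun h =>
              absurd (hd a ha) h.not_gt
          · exact hnew (hs s (by simp [hs']) a ha b hb) fun h =>
              absurd (hc s hs' a ha) h.not_gt
      · intro s hs' a ha b hb
        have hax : a ≤ x := by
          rcases List.mem_append.1 ha with ha | ha
          · exact ht a ha
          · exact (List.mem_singleton.1 ha).le
        rcases mem_consRow hs' with rfl | hs'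
        · exact hdesc (hur b (hdr hb)) hax (hd b hb)
        · exact hdesc (hsub' b (List.mem_flatten.2 ⟨s, hs', hb⟩)) hax (hc s hs' b hb)
      · exact fun s hs' a ha b hb h => hn1 s hs' a (hdr ha) b hb (hold h)
      · exact hn.imp fun h a ha b hb h' => h a ha b hb (hold h')

/-- Prepending x only creates descents starting at x, so it spoils exactly the intervals [a, b] with
x ≤ b that contain a letter of u in [a, x). The rows already passed have all their entries below x,
which is what `hlow` carries through the induction. -/
theorem sortedOn_leftInsertRows (x : α) (u : List α) (M : List (List α)) (hM : IsRows M)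
    (hsub : ∀ y ∈ M.flatten, y ∈ u) (hlow : ∀ c ∈ u, c ∈ M.flatten ∨ c < x)
    (hs : ∀ r ∈ M, ∀ a ∈ r, ∀ b ∈ r, SortedOn u a b)
    (hn : M.Pairwise fun r s => ∀ a ∈ r, ∀ b ∈ s, ¬ SortedOn u a b) :
    (∀ r ∈ leftInsertRows x M, ∀ a ∈ r, ∀ b ∈ r, SortedOn (x :: u) a b) ∧
    (leftInsertRows x M).Pairwise fun r s => ∀ a ∈ r, ∀ b ∈ s, ¬ SortedOn (x :: u) a b := by
  induction M with
  | nil => simp [leftInsertRows, sortedOn_self]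
  | cons r M ih =>
    rw [isRows_cons] at hM
    obtain ⟨hne, hr, hlt, hM⟩ := hM
    rw [List.pairwise_cons] at hn
    obtain ⟨hn1, hn⟩ := hn
    have hur : ∀ y ∈ r, y ∈ u := fun y hy => hsub y (by simp [hy])
    have hsub' : ∀ y ∈ M.flatten, y ∈ u := fun y hy =>
      hsub y (by rw [List.flatten_cons]; exact List.mem_append_right _ hy)
    have hold : ∀ {a b}, SortedOn (x :: u) a b → SortedOn u a b :=
      fun h => (sortedOn_cons.1 h).2
    have hnew : ∀ {a b}, SortedOn u a b → (x ≤ b → x ≤ a) → SortedOn (x :: u) a b :=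
      fun h hb => sortedOn_cons.2 ⟨fun d _ had hxb => (hb hxb).trans had, h⟩
    have hdesc : ∀ {a b}, a ∈ u → a < x → x ≤ b → ¬ SortedOn (x :: u) a b :=
      fun ha hax hxb h => absurd ((sortedOn_cons.1 h).1 _ ha le_rfl hxb) hax.not_ge
    rw [leftInsertRows]
    split_ifs with hc
    · obtain ⟨y, hy, hxy⟩ := hc
      have hx : ∀ b ∈ M.flatten, x < b := fun b hb => lt_of_le_of_lt hxy (hlt y hy b hb)
      have ht := takeWhile_lt x r
      have htr := (List.takeWhile_sublist (fun y => decide (y < x)) (l := r)).subset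
      have hd := le_dropWhile x r hr
      have hdr := (List.dropWhile_sublist (fun y => decide (y < x)) (l := r)).subset
      have hxb : ∀ b ∈ r, SortedOn u x b := by
        intro b hb
        refine List.Pairwise.imp_of_mem (R := fun c d => d ∈ r → c ≤ b → c ≤ d) ?_ ?_
        · intro c d hcu hdu h hxd hcb
          rcases hlow d hdu with hdM | hdM
          · rw [List.flatten_cons, List.mem_append] at hdM
            rcases hdM with hdr | hdM
            · exact h hdr hcb
            · exact hcb.trans (hlt b hb d hdM).le
          · exact absurd hdM hxd.not_gt
        · refine List.pairwise_iff_forall_sublist.2 fun {c d} hcd hdr hcb => ?_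
          have := (hs r (by simp) d hdr b hb).sublist hcd
          exact (sortedOn_cons.1 this).1 d (by simp) le_rfl hcb
      generalize r.takeWhile (fun y => decide (y < x)) = A at ht htr
      generalize r.dropWhile (fun y => decide (y < x)) = B at hd hdr
      have hB : ∀ b ∈ x :: B, x ≤ b := List.forall_mem_cons.2 ⟨le_rfl, hd⟩
      refine ⟨?_, pairwise_consRow ?_ (List.pairwise_cons.2 ⟨?_, ?_⟩)⟩
      · intro s hs' a ha b hb
        rcases mem_consRow hs' with rfl | hs'
        · exact hnew (hs r (by simp) a (htr ha) b (htr hb)) fun h => absurd (ht b hb) h.not_gt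
        · rcases List.mem_cons.1 hs' with rfl | hs'
          · refine hnew ?_ fun _ => hB a ha
            rcases List.mem_cons.1 hb with rfl | hb
            · exact sortedOn_of_lt _ (hB a ha)
            · exact (hxb b (hdr hb)).mono (hB a ha) le_rfl
          · exact hnew (hs s (by simp [hs']) a ha b hb) fun _ =>
              (hx a (List.mem_flatten.2 ⟨s, hs', ha⟩)).le
      · intro s hs' a ha b hb
        refine hdesc (hur a (htr ha)) (ht a ha) ?_
        rcases List.mem_cons.1 hs' with rfl | hs'
        · exact hB b hb
        · exact (hx b (List.mem_flatten.2 ⟨s, hs', hb⟩)).le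
      · intro s hs' a ha b hb h
        rcases List.mem_cons.1 ha with rfl | ha
        -- The new letter x need not occur in u; the entry y ≥ x of r replaces it, since [y, b] is
        -- contained in [x, b].
        · exact hn1 s hs' y hy b hb ((hold h).mono hxy le_rfl)
        · exact hn1 s hs' a (hdr ha) b hb (hold h)
      · exact hn.imp fun h a ha b hb h' => h a ha b hb (hold h')
    · push Not at hc
      obtain ⟨ih1, ih2⟩ := ih hM hsub' (fun c hcu => by
          rcases hlow c hcu with h | h
          · rw [List.flatten_cons, List.mem_append] at h
            exact h.symm.imp_right fun h => hc c h
          · exact Or.inr h)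
        (fun s h => hs s (List.mem_cons_of_mem _ h)) hn
      refine ⟨List.forall_mem_cons.2 ⟨fun a ha b hb => hnew (hs r (by simp) a ha b hb) fun h =>
        absurd (hc b hb) h.not_gt, ih1⟩, List.pairwise_cons.2 ⟨fun s' hs' a ha b hb h => ?_, ih2⟩⟩
      rcases mem_flatten_leftInsertRows x M b (List.mem_flatten.2 ⟨s', hs', hb⟩) with rfl | hbM
      · exact hdesc (hur a ha) (hc a ha) le_rfl h
      · obtain ⟨t, ht, hbt⟩ := List.mem_flatten.1 hbM
        exact hn1 t ht a ha b hbt (hold h)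

theorem IsRowsOf.rightInsertRows {u : List α} {M : List (List α)} (h : IsRowsOf u M) (x : α) :
    IsRowsOf (u ++ [x]) (rightInsertRows x M) := by
  have := sortedOn_rightInsertRows x u M h.isRows (fun y hy => h.perm.mem_iff.1 hy)
    (fun c hc => Or.inl (h.perm.mem_iff.2 hc)) h.sortedOn h.not_sortedOn
  exact ⟨h.isRows.rightInsertRows x, (perm_rightInsertRows x M).trans (h.perm.append_right _),
    this.1, this.2⟩

theorem IsRowsOf.leftInsertRows {u : List α} {M : List (List α)} (h : IsRowsOf u M) (x : α) :
    IsRowsOf (x :: u) (leftInsertRows x M) := by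
  have := sortedOn_leftInsertRows x u M h.isRows (fun y hy => h.perm.mem_iff.1 hy)
    (fun c hc => Or.inl (h.perm.mem_iff.2 hc)) h.sortedOn h.not_sortedOn
  exact ⟨h.isRows.leftInsertRows x, (perm_leftInsertRows x M).trans (h.perm.cons _),
    this.1, this.2⟩

theorem isRowsOf_nil : IsRowsOf ([] : List α) [] :=
  ⟨by simp [IsRows], by simp, by simp, by simp⟩

end

end Ribbon

/-! ### The constructors compute the rows associated with a word. -/

namespace QuasiRibbon

open Ribbon

variable {n : ℕ}

theorem rows_rightInsert (q : QuasiRibbon n) (x : Fin n) :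
    (q.rightInsert x).rows = rightInsertRows x q.rows :=
  transpose_transpose _ (q.isCols.isRows_transpose.rightInsertRows x).1

theorem rows_leftInsert (q : QuasiRibbon n) (x : Fin n) :
    (q.leftInsert x).rows = leftInsertRows x q.rows :=
  transpose_transpose _ (q.isCols.isRows_transpose.leftInsertRows x).1

theorem rows_injective : Function.Injective (rows : QuasiRibbon n → List (List (Fin n))) := by
  intro p q h
  ext1
  rw [← transpose_transpose _ p.cols_ne_nil, ← transpose_transpose _ q.cols_ne_nil]
  exact congrArg transpose h

theorem isRowsOf_foldl (u : List (Fin n)) : IsRowsOf u (u.foldl rightInsert empty).rows := by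
  induction u using List.reverseRecOn with
  | nil => exact isRowsOf_nil
  | append_singleton u x ih =>
    rw [List.foldl_append, List.foldl_cons, List.foldl_nil, rows_rightInsert]
    exact ih.rightInsertRows x

theorem isRowsOf_foldr (u : List (Fin n)) :
    IsRowsOf u (u.foldr (fun x e => leftInsert e x) empty).rows := by
  induction u with
  | nil => exact isRowsOf_nil
  | cons x u ih =>
    rw [List.foldr_cons, rows_leftInsert]
    exact ih.leftInsertRows x

theorem foldr_eq_foldl (u : List (Fin n)) :
    u.foldr (fun x e => leftInsert e x) empty = u.foldl rightInsert empty :=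
  rows_injective ((isRowsOf_foldr u).unique (isRowsOf_foldl u))

theorem foldl_eq_foldl_iff (u v : List (Fin n)) :
    u.foldl rightInsert empty = v.foldl rightInsert empty ↔ IntervalEquiv u v := by
  refine ⟨fun h => (isRowsOf_foldl u).intervalEquiv (h ▸ isRowsOf_foldl v), fun h => ?_⟩
  exact rows_injective (((isRowsOf_foldl u).congr h).unique (isRowsOf_foldl v))

end QuasiRibbon

/-! ## Commutation of two letters in the presence of a third one -/

section

open Ribbon

variable {n : ℕ}

/-- The hypoplactic congruence on lists. -/
def HypoEquiv (u v : List (Fin n)) : Prop :=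
  hypoplacticCon n (FreeMonoid.ofList u) (FreeMonoid.ofList v)

/-! ### The congruence on words, its duality and its invariant. -/

namespace HypoEquiv

theorem refl (u : List (Fin n)) : HypoEquiv u u := (hypoplacticCon n).refl _

theorem symm {u v : List (Fin n)} (h : HypoEquiv u v) : HypoEquiv v u := (hypoplacticCon n).symm h

theorem trans {u v w : List (Fin n)} (h : HypoEquiv u v) (h' : HypoEquiv v w) : HypoEquiv u w :=
  (hypoplacticCon n).trans h h'

theorem append {u u' v v' : List (Fin n)} (h : HypoEquiv u u') (h' : HypoEquiv v v') :
    HypoEquiv (u ++ v) (u' ++ v') :=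
  (hypoplacticCon n).mul h h'

theorem context (p q : List (Fin n)) {u v : List (Fin n)} (h : HypoEquiv u v) :
    HypoEquiv (p ++ (u ++ q)) (p ++ (v ++ q)) :=
  (refl p).append (h.append (refl q))

theorem of_rel {u v : List (Fin n)} (h : HypoplacticRel n (.ofList u) (.ofList v)) :
    HypoEquiv u v :=
  ConGen.Rel.of _ _ h

/-- The anti-automorphism of the hypoplactic congruence that reverses words and the order of the
letters. -/
theorem dual {u v : List (Fin n)} (h : HypoEquiv u v) :
    HypoEquiv (u.reverse.map Fin.rev) (v.reverse.map Fin.rev) := by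
  have key : ∀ x y : FreeMonoid (Fin n), ConGen.Rel (HypoplacticRel n) x y →
      HypoEquiv (x.toList.reverse.map Fin.rev) (y.toList.reverse.map Fin.rev) := by
    intro x y h
    induction h with
    | of x y h =>
      cases h with
      | knuth_left x y z h1 h2 =>
        exact (of_rel (.knuth_right z.rev y.rev x.rev (Fin.rev_lt_rev.2 h2)
          (Fin.rev_le_rev.2 h1)))
      | knuth_right x y z h1 h2 =>
        exact (of_rel (.knuth_left z.rev y.rev x.rev (Fin.rev_le_rev.2 h2)
          (Fin.rev_lt_rev.2 h1)))
      | quartic_left x y z t h1 h2 h3 =>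
        exact (of_rel (.quartic_left t.rev z.rev y.rev x.rev (Fin.rev_le_rev.2 h3)
          (Fin.rev_lt_rev.2 h2) (Fin.rev_le_rev.2 h1)))
      | quartic_right x y z t h1 h2 h3 =>
        exact (of_rel (.quartic_right t.rev z.rev y.rev x.rev (Fin.rev_lt_rev.2 h3)
          (Fin.rev_le_rev.2 h2) (Fin.rev_lt_rev.2 h1)))
    | refl x => exact refl _
    | symm _ ih => exact ih.symm
    | trans _ _ ih1 ih2 => exact ih1.trans ih2
    | mul _ _ ih1 ih2 =>
      simp only [FreeMonoid.toList_mul, List.reverse_append, List.map_append]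
      exact ih2.append ih1
  exact key _ _ h

/-- Whenever a relation exchanges two letters, a third letter between them in value already forms a
descent inside every interval containing both, on each side of the relation. -/
theorem intervalEquiv {u v : List (Fin n)} (h : HypoEquiv u v) : IntervalEquiv u v := by
  have key : ∀ x y : FreeMonoid (Fin n), ConGen.Rel (HypoplacticRel n) x y →
      IntervalEquiv x.toList y.toList := by
    intro x y h
    induction h with
    | of x y h =>
      cases h with
      | knuth_left x y z h1 h2 =>
        refine ⟨List.Perm.swap x z [y], fun a b => ?_⟩
        simp [sortedOn_cons, sortedOn_nil]; grind
      | knuth_right x y z h1 h2 =>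
        refine ⟨(List.Perm.swap x z []).cons y, fun a b => ?_⟩
        simp [sortedOn_cons, sortedOn_nil]; grind
      | quartic_left x y z t h1 h2 h3 =>
        refine ⟨(List.Perm.swap x z [t, y]).trans (((List.Perm.swap y t []).cons z).cons x),
          fun a b => ?_⟩
        simp [sortedOn_cons, sortedOn_nil]; grind
      | quartic_right x y z t h1 h2 h3 =>
        refine ⟨(List.Perm.swap y t [z, x]).trans (((List.Perm.swap x z []).cons t).cons y),
          fun a b => ?_⟩
        simp [sortedOn_cons, sortedOn_nil]; grind
    | refl x => exact ⟨.refl _, fun _ _ => Iff.rfl⟩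
    | symm _ ih => exact ih.symm
    | trans _ _ ih1 ih2 => exact ih1.trans ih2
    | mul _ _ ih1 ih2 => exact ih1.append ih2
  exact key _ _ h

end HypoEquiv
end

section

open Ribbon

variable {n : ℕ}

/-- A letter that allows the letters `y` and `z` to commute if it stands on their left. -/
def LeftWitness (w y z : Fin n) : Prop := (y < w ∧ w ≤ z) ∨ (z < w ∧ w ≤ y)

/-- A letter that allows the letters `y` and `z` to commute if it stands on their right. -/
def RightWitness (w y z : Fin n) : Prop := (y ≤ w ∧ w < z) ∨ (z ≤ w ∧ w < y)

/-- Adjacent letters commute if there is a witness on their left at distance less than `m`. -/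
def SwapLeft (n m : ℕ) : Prop := ∀ (w : Fin n) (s : List (Fin n)) (y z : Fin n), s.length < m →
  LeftWitness w y z → HypoEquiv (w :: (s ++ [y, z])) (w :: (s ++ [z, y]))

/-- Adjacent letters commute if there is a witness on their right at distance less than `m`. -/
def SwapRight (n m : ℕ) : Prop := ∀ (w : Fin n) (s : List (Fin n)) (y z : Fin n), s.length < m →
  RightWitness w y z → HypoEquiv (y :: z :: (s ++ [w])) (z :: y :: (s ++ [w]))

theorem SwapLeft.context {m : ℕ} (h : SwapLeft n m) (p : List (Fin n)) (w : Fin n)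
    (s : List (Fin n)) (y z : Fin n) (q : List (Fin n)) (hs : s.length < m)
    (hw : LeftWitness w y z) :
    HypoEquiv (p ++ w :: (s ++ y :: z :: q)) (p ++ w :: (s ++ z :: y :: q)) := by
  simpa using (h w s y z hs hw).context p q

theorem SwapRight.context {m : ℕ} (h : SwapRight n m) (p : List (Fin n)) (w : Fin n)
    (s : List (Fin n)) (y z : Fin n) (q : List (Fin n)) (hs : s.length < m)
    (hw : RightWitness w y z) :
    HypoEquiv (p ++ y :: z :: (s ++ w :: q)) (p ++ z :: y :: (s ++ w :: q)) := by
  simpa using (h w s y z hs hw).context p q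

theorem SwapLeft.swapRight {m : ℕ} (h : SwapLeft n m) : SwapRight n m := by
  intro w s y z hs hw
  have := (h w.rev (s.reverse.map Fin.rev) z.rev y.rev (by simpa using hs) (by
    unfold LeftWitness
    unfold RightWitness at hw
    simp only [Fin.rev_lt_rev, Fin.rev_le_rev]
    tauto)).dual
  simpa [Function.comp_def] using this

/-- The letter c passes the letters of A one at a time, with fewer than |A| + |B| letters between
the swapped pair and w. -/
theorem SwapRight.move {m : ℕ} (h : SwapRight n m) (w c : Fin n) (A B : List (Fin n))
    (hA : ∀ d ∈ A, RightWitness w c d) (hAB : A.length + B.length ≤ m) :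
    HypoEquiv (c :: (A ++ B ++ [w])) (A ++ c :: B ++ [w]) := by
  induction A with
  | nil => exact .refl _
  | cons d A ih =>
    have h1 := h w (A ++ B) c d (by simp at hAB ⊢; omega) (hA d (by simp))
    have h2 := (ih (fun e he => hA e (by simp [he])) (by simp at hAB ⊢; omega)).context [d] []
    simpa using h1.trans (by simpa using h2)

/-- Before a letter `w`, letters of two types commute if `w` is a witness for them. -/
theorem SwapRight.separate {m : ℕ} (h : SwapRight n m) (w : Fin n) (P : Fin n → Bool)
    (s : List (Fin n)) (hs : s.length ≤ m + 1)
    (hP : ∀ c ∈ s, ∀ d ∈ s, P c = false → P d = true → RightWitness w c d) :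
    HypoEquiv (s ++ [w]) (s.filter P ++ s.filter (fun c => !P c) ++ [w]) := by
  induction s with
  | nil => exact .refl _
  | cons c s ih =>
    have ih := (ih (by simp at hs; omega) (fun c hc d hd => hP c (by simp [hc]) d
      (by simp [hd]))).context [c] []
    rcases hc : P c with _ | _
    · have hlen := List.length_eq_length_filter_add (l := s) P
      have := h.move w c (s.filter P) (s.filter fun c => !P c)
        (fun d hd => hP c (by simp) d (by simp [(List.mem_filter.1 hd).1]) hc
          (List.mem_filter.1 hd).2) (by simp at hs; omega)
      simpa [hc] using HypoEquiv.trans (by simpa using ih) this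
    · simpa [hc] using ih

/-! ### Witnesses at arbitrary distance. -/

section

variable {m : ℕ} {x a t : Fin n}

/-- Exchanging a with c brings the witness a one letter closer to the pair; after the swap the
exchange is undone. -/
theorem SwapLeft.of_first (hl : SwapLeft n m) (hr : SwapRight n m) (hxa : x < a) (hat : a ≤ t)
    (c : Fin n) (s : List (Fin n)) (hs : s.length + 1 = m) (hw : ∃ w ∈ s, RightWitness w a c) :
    HypoEquiv (a :: (c :: s ++ [t, x])) (a :: (c :: s ++ [x, t])) := by
  obtain ⟨w, hw, hw'⟩ := hw
  obtain ⟨p, q, rfl⟩ := List.append_of_mem hw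
  have hswap : ∀ r, HypoEquiv (a :: (c :: (p ++ w :: q) ++ r)) (c :: a :: (p ++ w :: q ++ r)) := by
    intro r
    simpa using hr.context [] w p a c (q ++ r) (by simp at hs; omega) hw'
  have h := hl.context [c] a (p ++ w :: q) t x [] (by omega) (Or.inr ⟨hxa, hat⟩)
  exact ((hswap _).trans (by simpa using h)).trans (hswap _).symm

/-- Carrying c to the right across both t and x shortens the gap by one; it is carried back after
the swap. -/
theorem SwapLeft.of_last (hl : SwapLeft n m) (hxa : x < a) (hat : a ≤ t)
    (c : Fin n) (s : List (Fin n)) (hs : s.length + 1 = m)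
    (hw : ∃ w ∈ s, LeftWitness w c x ∧ LeftWitness w c t) :
    HypoEquiv (a :: (s ++ [c] ++ [t, x])) (a :: (s ++ [c] ++ [x, t])) := by
  obtain ⟨w, hw, hwx, hwt⟩ := hw
  have h := hl.context [] a s t x [c] (by omega) (Or.inr ⟨hxa, hat⟩)
  obtain ⟨p, q, rfl⟩ := List.append_of_mem hw
  have hswap : ∀ y z, LeftWitness w c y → LeftWitness w c z →
      HypoEquiv (a :: (p ++ w :: q ++ [c] ++ [y, z])) (a :: (p ++ w :: q ++ [y, z, c])) := by
    intro y z hy hz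
    have h1 := hl.context (a :: p) w q c y [z] (by simp at hs; omega) hy
    have h2 := hl.context (a :: p) w (q ++ [y]) c z [] (by simp at hs ⊢; omega) hz
    simpa using h1.trans (by simpa using h2)
  exact ((hswap t x hwt hwx).trans (by simpa using h)).trans (hswap x t hwx hwt).symm

/-- The gap is followed by t in one word and by x in the other, so both must serve as witnesses for
rearranging it. -/
theorem SwapLeft.of_rearrangement (hr : SwapRight n m) (P : Fin n → Bool)
    (s : List (Fin n)) (hs : s.length ≤ m)
    (hP : ∀ c ∈ s, ∀ d ∈ s, P c = false → P d = true → RightWitness t c d ∧ RightWitness x c d)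
    (h : HypoEquiv (a :: (s.filter P ++ s.filter (fun c => !P c) ++ [t, x]))
      (a :: (s.filter P ++ s.filter (fun c => !P c) ++ [x, t]))) :
    HypoEquiv (a :: (s ++ [t, x])) (a :: (s ++ [x, t])) := by
  have h1 := (hr.separate t P s (by omega) fun c hc d hd h h' => (hP c hc d hd h h').1).context
    [a] [x]
  have h2 := (hr.separate x P s (by omega) fun c hc d hd h h' => (hP c hc d hd h h').2).context
    [a] [t]
  simp only [List.append_assoc, List.cons_append, List.nil_append] at h h1 h2 ⊢
  exact (h1.trans h).trans h2.symm

/-- A quartic relation makes the desired swap but also exchanges a and l; a Knuth relation restores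
them. -/
theorem HypoEquiv.swap_of_low {l : Fin n} (hlx : l ≤ x) (hxa : x < a) (hat : a ≤ t) :
    HypoEquiv [a, l, t, x] [a, l, x, t] :=
  (of_rel (.quartic_left l x a t hlx hxa hat)).trans
    ((of_rel (.knuth_left l x a hlx hxa)).symm.append (refl [t]))

theorem HypoEquiv.swap_of_high {h : Fin n} (hxa : x < a) (hat : a ≤ t) (hth : t < h) :
    HypoEquiv [a, h, t, x] [a, h, x, t] :=
  ((of_rel (.knuth_left a t h hat hth)).symm.append (refl [x])).trans
    (of_rel (.quartic_right x a t h hxa hat hth))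

/-- Each quartic relation is used once, to exchange a with l and then with h; each also swaps t and
x. In between, a is adjacent to that pair and lets it be swapped back, so three swaps in all leave
one. -/
theorem SwapLeft.swap_of_low_high (hl : SwapLeft n 2) (hr : SwapRight n 2) {l h : Fin n}
    (hlx : l ≤ x) (hxa : x < a) (hat : a ≤ t) (hth : t < h) :
    HypoEquiv [a, l, h, t, x] [a, l, h, x, t] := by
  have h1 : HypoEquiv [a, l, h, t, x] [a, h, l, t, x] :=
    hr.context [a] t [] l h [x] (by simp) (Or.inl ⟨by order, hth⟩)
  have h2 : HypoEquiv [a, h, l, t, x] [h, a, l, t, x] :=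
    hr.context [] t [l] a h [x] (by simp) (Or.inl ⟨hat, hth⟩)
  have h3 : HypoEquiv [h, a, l, t, x] [h, l, a, x, t] :=
    (HypoEquiv.of_rel (.quartic_left l x a t hlx hxa hat)).context [h] []
  have h4 : HypoEquiv [h, l, a, x, t] [l, h, a, x, t] :=
    hr.context [] a [] h l [x, t] (by simp) (Or.inr ⟨by order, by order⟩)
  have h5 : HypoEquiv [l, h, a, x, t] [l, h, a, t, x] :=
    hl.context [l, h] a [] x t [] (by simp) (Or.inl ⟨hxa, hat⟩)
  have h6 : HypoEquiv [l, h, a, t, x] [l, a, h, x, t] :=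
    (HypoEquiv.of_rel (.quartic_right x a t h hxa hat hth)).context [l] []
  have h7 : HypoEquiv [l, a, h, x, t] [a, l, h, x, t] :=
    hr.context [] x [h] l a [t] (by simp) (Or.inl ⟨hlx, hxa⟩)
  exact h1.trans (h2.trans (h3.trans (h4.trans (h5.trans (h6.trans h7)))))

/-- The letters of the gap are low (≤ x) or high (> t), and low ones commute with high ones in front
of t or x, so the gap may be arranged as AB or BA. If there are two low or two high letters, compare
the first and the last of that kind: depending on their order, either the first can be exchanged
with a, or the last can be carried past t and x. This leaves at most one letter of each kind, hence
four explicit cases. -/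
theorem SwapLeft.of_separated (hl : SwapLeft n m) (hr : SwapRight n m) (hxa : x < a) (hat : a ≤ t)
    (s A B : List (Fin n)) (hs : s.length = m) (hsxt : ∀ c ∈ s, c ≤ x ∨ t < c)
    (hA : A = s.filter fun c => decide (c ≤ x)) (hB : B = s.filter fun c => !decide (c ≤ x)) :
    HypoEquiv (a :: (s ++ [t, x])) (a :: (s ++ [x, t])) := by
  have hA' : ∀ c ∈ A, c ≤ x := fun c hc => by
    rw [hA] at hc
    simpa using (List.mem_filter.1 hc).2
  have hB' : ∀ c ∈ B, t < c := fun c hc => by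
    rw [hB] at hc
    have := List.mem_filter.1 hc
    exact (hsxt c this.1).resolve_left (by simpa using this.2)
  have hlen : A.length + B.length = m := by
    rw [hA, hB, ← hs]; exact (List.length_eq_length_filter_add _).symm
  have hAB : HypoEquiv (a :: (A ++ B ++ [t, x])) (a :: (A ++ B ++ [x, t])) →
      HypoEquiv (a :: (s ++ [t, x])) (a :: (s ++ [x, t])) := by
    intro h
    refine SwapLeft.of_rearrangement hr (fun c => decide (c ≤ x)) s hs.le ?_ (by rwa [← hA, ← hB])
    intro c hc d hd h1 h2
    simp only [decide_eq_false_iff_not, decide_eq_true_eq] at h1 h2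
    have := (hsxt c hc).resolve_left h1
    unfold RightWitness
    constructor <;> right <;> constructor <;> order
  have hBA : HypoEquiv (a :: (B ++ A ++ [t, x])) (a :: (B ++ A ++ [x, t])) →
      HypoEquiv (a :: (s ++ [t, x])) (a :: (s ++ [x, t])) := by
    intro h
    refine SwapLeft.of_rearrangement hr (fun c => !decide (c ≤ x)) s hs.le ?_
      (by simp only [Bool.not_not]; rwa [← hA, ← hB])
    intro c hc d hd h2 h1
    simp only [Bool.not_eq_false', Bool.not_eq_true', decide_eq_false_iff_not,
      decide_eq_true_eq] at h1 h2
    have := (hsxt d hd).resolve_left h1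
    unfold RightWitness
    constructor <;> left <;> constructor <;> order
  have hcases : ∀ C : List (Fin n), C = [] ∨ (∃ c, C = [c]) ∨ ∃ c D d, C = c :: (D ++ [d]) := by
    rintro (_ | ⟨c, C⟩)
    · simp
    · rcases List.eq_nil_or_concat C with rfl | ⟨D, d, rfl⟩
      · simp
      · exact Or.inr (Or.inr ⟨c, D, d, by simp⟩)
  have hlow := hcases A
  have hhigh := hcases B
  clear hA hB
  have hlong : (∃ l D l', A = l :: (D ++ [l'])) →
      HypoEquiv (a :: (s ++ [t, x])) (a :: (s ++ [x, t])) := by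
    rintro ⟨l, D, l', rfl⟩
    have h1 : l ≤ x := hA' l (by simp)
    have h2 : l' ≤ x := hA' l' (by simp)
    by_cases hll : l ≤ l'
    · exact hAB (hl.of_first hr hxa hat l (D ++ [l'] ++ B) (by simp at hlen ⊢; omega)
        ⟨l', by simp, Or.inr ⟨hll, by order⟩⟩)
    · apply hBA
      have := hl.of_last hxa hat l' (B ++ l :: D) (by simp at hlen ⊢; omega)
        ⟨l, by simp, Or.inl ⟨by order, by order⟩, Or.inl ⟨by order, by order⟩⟩
      simpa using this
  rcases hhigh with hB0 | ⟨h, hB0⟩ | ⟨h, D, h', rfl⟩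
  rotate_left 2
  · have h1 : t < h := hB' h (by simp)
    have h2 : t < h' := hB' h' (by simp)
    by_cases hhh : h ≤ h'
    · apply hAB
      have := hl.of_last hxa hat h' (A ++ h :: D) (by simp at hlen ⊢; omega)
        ⟨h, by simp, Or.inr ⟨by order, by order⟩, Or.inr ⟨by order, by order⟩⟩
      simpa using this
    · exact hBA (hl.of_first hr hxa hat h (D ++ [h'] ++ A) (by simp at hlen ⊢; omega)
        ⟨h', by simp, Or.inl ⟨by order, by order⟩⟩)
  all_goals
    rcases hlow with rfl | ⟨l, rfl⟩ | hlow
    rotate_left 2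
    · exact hlong hlow
  all_goals
    subst hB0
    apply hAB
  · exact (HypoEquiv.of_rel (.knuth_right x a t hxa hat))
  · exact .swap_of_low (hA' l (by simp)) hxa hat
  · exact .swap_of_high hxa hat (hB' h (by simp))
  · obtain rfl : 2 = m := by simpa using hlen
    exact hl.swap_of_low_high hr (hA' l (by simp)) hxa hat (hB' h (by simp))

/-- Induction on the distance: a letter of the gap lying in (x, t] is a nearer witness; otherwise
the gap splits into low and high letters. -/
theorem swapLeft (n m : ℕ) : SwapLeft n m := by
  induction m with
  | zero => exact fun _ _ _ _ h => absurd h (Nat.not_lt_zero _)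
  | succ m hl =>
    have key : ∀ (a : Fin n) (s : List (Fin n)) (t x : Fin n), s.length < m + 1 → x < a → a ≤ t →
        HypoEquiv (a :: (s ++ [t, x])) (a :: (s ++ [x, t])) := by
      intro a s t x hs hxa hat
      by_cases hw : ∃ c ∈ s, x < c ∧ c ≤ t
      · obtain ⟨c, hc, hxc, hct⟩ := hw
        obtain ⟨p, q, rfl⟩ := List.append_of_mem hc
        simpa using hl.context (a :: p) c q t x [] (by simp at hs; omega) (Or.inr ⟨hxc, hct⟩)
      · push Not at hw
        rcases (Nat.lt_succ_iff.1 hs).lt_or_eq with hs | hs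
        · exact hl a s t x hs (Or.inr ⟨hxa, hat⟩)
        · exact hl.of_separated hl.swapRight hxa hat s _ _ hs
            (fun c hc => (le_or_gt c x).imp_right (hw c hc)) rfl rfl
    rintro w s y z hs (⟨h1, h2⟩ | ⟨h1, h2⟩)
    · exact (key w s z y hs h1 h2).symm
    · exact key w s y z hs h1 h2

/-- Adjacent letters `y` and `z` commute if a witness occurs on their left or on their right. -/
theorem HypoEquiv.swap (p q : List (Fin n)) (y z : Fin n)
    (h : (∃ w ∈ p, LeftWitness w y z) ∨ ∃ w ∈ q, RightWitness w y z) :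
    HypoEquiv (p ++ y :: z :: q) (p ++ z :: y :: q) := by
  rcases h with ⟨w, hw, h⟩ | ⟨w, hw, h⟩
  · obtain ⟨p, s, rfl⟩ := List.append_of_mem hw
    simpa using (swapLeft n _).context p w s y z q (Nat.lt_succ_self _) h
  · obtain ⟨s, q, rfl⟩ := List.append_of_mem hw
    exact (swapLeft n _).swapRight.context p w s y z q (Nat.lt_succ_self _) h

end

/-! ## Interval equivalent words are congruent -/

/-- In a word that has the same letters as `v ++ c :: x :: q` after the prefix `p` and that is
interval equivalent to `p ++ v ++ c :: x :: q`, but has `x` as the next letter after `p`, the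
letters `c` and `x` of the latter word commute. -/
theorem HypoEquiv.swap_of_intervalEquiv (p u v q : List (Fin n)) (c x : Fin n) (hcx : c ≠ x)
    (hxv : x ∉ v) (h : IntervalEquiv (p ++ x :: u) (p ++ v ++ c :: x :: q)) :
    HypoEquiv (p ++ v ++ c :: x :: q) (p ++ v ++ x :: c :: q) := by
  have hperm : u.Perm (v ++ c :: q) := by
    have h1 := h.1
    rw [List.append_assoc, List.perm_append_left_iff] at h1
    refine List.Perm.cons_inv (a := x) (h1.trans ?_)
    rw [← List.singleton_append (x := c), ← List.append_assoc]
    exact List.perm_middle.trans (by simp)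
  apply HypoEquiv.swap
  by_contra hcon
  push Not at hcon
  obtain ⟨hL, hR⟩ := hcon
  simp only [LeftWitness, RightWitness] at hL hR
  have hL' := (List.forall_mem_append.1 hL).2
  rcases lt_or_gt_of_ne hcx with hcx | hcx
  -- Without witnesses, the letters of p and v in [c, x] equal c and those of q equal x, so the
  -- second word is sorted on [c, x]. In the first word x precedes the c found in u.
  · have h1 : ¬ SortedOn (p ++ x :: u) c x := by
      intro h1
      have := (sortedOn_cons.1 (sortedOn_append.1 h1).2.1).1 c (hperm.mem_iff.2 (by simp)) le_rfl
        le_rfl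
      order
    refine h1 ((h.2 c x).2 (List.pairwise_append.2 ⟨?_, ?_, ?_⟩))
    · refine List.Pairwise.imp_of_mem (R := fun _ _ => True) ?_ (List.pairwise_of_forall (by simp))
      grind
    · refine List.pairwise_cons.2 ⟨by grind, List.pairwise_cons.2 ⟨by grind, ?_⟩⟩
      refine List.Pairwise.imp_of_mem (R := fun _ _ => True) ?_ (List.pairwise_of_forall (by simp))
      grind
    · grind
  -- Now the letters of p in [x, c] equal x, those of q equal c, and v has none because x ∉ v. So
  -- the first word is sorted on [x, c], whereas c precedes x in the second.
  · have h1 : ¬ SortedOn (p ++ v ++ c :: x :: q) x c := by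
      intro h1
      have := (sortedOn_cons.1 (sortedOn_append.1 h1).2.1).1 x (by simp) le_rfl le_rfl
      order
    refine h1 ((h.2 x c).1 (List.pairwise_append.2 ⟨?_, ?_, ?_⟩))
    · refine List.Pairwise.imp_of_mem (R := fun _ _ => True) ?_ (List.pairwise_of_forall (by simp))
      grind
    · have hu : ∀ d ∈ u, d ∈ v ∨ d = c ∨ d ∈ q := by simp [hperm.mem_iff]
      refine List.pairwise_cons.2 ⟨by grind, ?_⟩
      refine List.Pairwise.imp_of_mem (R := fun _ _ => True) ?_ (List.pairwise_of_forall (by simp))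
      grind
    · grind

theorem HypoEquiv.move_to_front (p u v q : List (Fin n)) (x : Fin n) (hxv : x ∉ v)
    (h : IntervalEquiv (p ++ x :: u) (p ++ v ++ x :: q)) :
    HypoEquiv (p ++ v ++ x :: q) (p ++ x :: (v ++ q)) := by
  induction v using List.reverseRecOn generalizing q with
  | nil => simpa using HypoEquiv.refl _
  | append_singleton v c ih =>
    have hc : c ≠ x := fun hc => hxv (by simp [hc])
    have hv : x ∉ v := fun hx => hxv (by simp [hx])
    have h1 := HypoEquiv.swap_of_intervalEquiv p u v q c x hc hv (by simpa using h)
    have h2 := ih (c :: q) hv ((by simpa using h : IntervalEquiv _ _).trans h1.intervalEquiv)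
    simpa using h1.trans h2

/-- The prefix p is the part already matched; it grows by one letter each time the first occurrence
of x in v is brought forward. -/
theorem hypoEquiv_append_of_intervalEquiv (u p v : List (Fin n))
    (h : IntervalEquiv (p ++ u) (p ++ v)) : HypoEquiv (p ++ u) (p ++ v) := by
  induction u generalizing p v with
  | nil =>
    obtain rfl : v = [] := by simpa using (List.perm_append_left_iff p).1 h.1
    exact .refl _
  | cons x u ih =>
    have hx : x ∈ v := ((List.perm_append_left_iff p).1 h.1).mem_iff.1 (by simp)
    obtain ⟨v, q, rfl, hxv⟩ := List.eq_append_cons_of_mem hx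
    have h1 := HypoEquiv.move_to_front p u v q x hxv (by simpa using h)
    have h2 := ih (p ++ [x]) (v ++ q) (by simpa using h.trans (by simpa using h1.intervalEquiv))
    simpa using HypoEquiv.trans (by simpa using h2) h1.symm

theorem hypoEquiv_iff_intervalEquiv {u v : List (Fin n)} : HypoEquiv u v ↔ IntervalEquiv u v :=
  ⟨HypoEquiv.intervalEquiv, hypoEquiv_append_of_intervalEquiv u [] v⟩

end

/-! ## The string data structures of quasi-ribbon tableaux -/

theorem Qrow_hasCrossSectionProperty (n : ℕ) :
    (Qrow n).HasCrossSectionProperty (hypoplacticCon n) := fun u v =>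
  hypoEquiv_iff_intervalEquiv.trans (QuasiRibbon.foldl_eq_foldl_iff u v).symm

theorem Qleft_hasCrossSectionProperty (n : ℕ) :
    (Qleft n).HasCrossSectionProperty (hypoplacticCon n) := by
  intro u v
  have h : ∀ w, (Qleft n).constructor w = (Qrow n).constructor w := QuasiRibbon.foldr_eq_foldl
  rw [h u, h v]
  exact Qrow_hasCrossSectionProperty n u v

/-! ### Consequences of the cross-section property. -/

namespace RightStringDataStructure

variable {n : ℕ} {S : RightStringDataStructure n} {r : Con (FreeMonoid (Fin n))}

theorem star_eq (d d' : S.Data) : S.star d d' = S.constructor (S.read d ++ S.read d') := by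
  have h : S.constructor (S.read d) = d := S.insertWord_read d
  rw [constructor, insertWord, List.foldl_append]
  exact congrArg (S.insertWord · (S.read d')) h.symm

theorem HasCrossSectionProperty.read_constructor (h : S.HasCrossSectionProperty r)
    (u : List (Fin n)) :
    r (FreeMonoid.ofList (S.read (S.constructor u))) (FreeMonoid.ofList u) :=
  (h _ _).2 (S.insertWord_read _)

/-- Both bracketings are constructors of words congruent to the concatenation of the three readings.
-/
theorem HasCrossSectionProperty.isAssociative (h : S.HasCrossSectionProperty r) :
    S.IsAssociative := by
  intro a b c
  simp only [star_eq]
  rw [← h]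
  have h1 := r.mul (h.read_constructor (S.read a ++ S.read b)) (r.refl (.ofList (S.read c)))
  have h2 := r.mul (r.refl (.ofList (S.read a))) (h.read_constructor (S.read b ++ S.read c))
  exact r.trans (by simpa [mul_assoc] using h1) (r.symm h2)

/-- The structure monoid of a string data structure with the cross-section property for a
congruence is isomorphic to the quotient by this congruence. -/
theorem HasCrossSectionProperty.nonempty_mulEquiv (h : S.HasCrossSectionProperty r) :
    Nonempty (S.StructureMonoid h.isAssociative ≃* r.Quotient) := by
  have hstar : ∀ d e : S.Data, r (FreeMonoid.ofList (S.read (S.star d e)))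
      (FreeMonoid.ofList (S.read d) * FreeMonoid.ofList (S.read e)) := by
    intro d e
    rw [star_eq]
    exact h.read_constructor _
  let f : S.StructureMonoid h.isAssociative →* r.Quotient :=
    { toFun := fun d => ((FreeMonoid.ofList (S.read d) : FreeMonoid (Fin n)) : r.Quotient)
      map_one' := by
        change ((FreeMonoid.ofList (S.read S.empty) : FreeMonoid (Fin n)) : r.Quotient) = 1
        rw [S.read_empty]
        rfl
      map_mul' := fun d e => (r.eq).2 (hstar d e) }
  refine ⟨MulEquiv.ofBijective f ⟨fun d e hde => ?_, fun x => ?_⟩⟩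
  · have := (h _ _).1 ((r.eq).1 hde)
    exact (S.insertWord_read d).symm.trans (this.trans (S.insertWord_read e))
  · induction x using Con.induction_on with
    | _ w => exact ⟨S.constructor w.toList, (r.eq).2 (h.read_constructor w.toList)⟩

end RightStringDataStructure

namespace LeftStringDataStructure

variable {n : ℕ} {S : LeftStringDataStructure n} {r : Con (FreeMonoid (Fin n))}

/-- Left insertion puts the second reading in front, so the product corresponds to concatenation in
the opposite order. -/
theorem star_eq (d d' : S.Data) : S.star d d' = S.constructor (S.read d' ++ S.read d) := by
  have h : S.constructor (S.read d) = d := S.insertWord_read d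
  rw [constructor, insertWord, List.foldr_append]
  exact congrArg (S.insertWord (S.read d') ·) h.symm

theorem HasCrossSectionProperty.read_constructor (h : S.HasCrossSectionProperty r)
    (u : List (Fin n)) :
    r (FreeMonoid.ofList (S.read (S.constructor u))) (FreeMonoid.ofList u) :=
  (h _ _).2 (S.insertWord_read _)

theorem HasCrossSectionProperty.isAssociative (h : S.HasCrossSectionProperty r) :
    S.IsAssociative := by
  intro a b c
  simp only [star_eq]
  rw [← h]
  have h1 := r.mul (r.refl (.ofList (S.read c))) (h.read_constructor (S.read b ++ S.read a))
  have h2 := r.mul (h.read_constructor (S.read c ++ S.read b)) (r.refl (.ofList (S.read a)))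
  exact r.trans (by simpa [mul_assoc] using h1) (r.symm h2)

end LeftStringDataStructure

theorem mainTheorem8 (n : ℕ) :
    (Qrow n).HasCrossSectionProperty (hypoplacticCon n) ∧
    (Qleft n).HasCrossSectionProperty (hypoplacticCon n) ∧
    (Qleft n).IsAssociative ∧
    ∃ h : (Qrow n).IsAssociative,
      Nonempty ((Qrow n).StructureMonoid h ≃* HypoplacticMonoid n) :=
  ⟨Qrow_hasCrossSectionProperty n, Qleft_hasCrossSectionProperty n,
    (Qleft_hasCrossSectionProperty n).isAssociative,
    (Qrow_hasCrossSectionProperty n).isAssociative,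
    -- The presented monoid is by definition the quotient by `hypoplacticCon n`.
    (Qrow_hasCrossSectionProperty n).nonempty_mulEquiv⟩
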